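/- Let $\mathcal X,\mathcal Y$ be finite non-empty sets, let $P_{\mathcal X}(\cdot|x)$ and $P_{\mathcal Y}(\cdot|y)$ be transition kernels on them, let $c:\mathcal X\times\mathcal Y\to[0,\infty)$, $\gamma\in(0,1)$, and write $xy$ for $(x,y)$ and $\|c\|_\infty=\max_{xy}c(xy)$. Fix initial states $x_0\in\mathcal X$, $y_0\in\mathcal Y$, and let $M_{\mathcal X}$, $M_{\mathcal Y}$ be the laws on $\mathcal X^{\mathbb N}$, $\mathcal Y^{\mathbb N}$ of the Markov chains $(X_t)_{t\ge0}$, $(Y_t)_{t\ge0}$ with these kernels and $X_0=x_0$, $Y_0=y_0$. A coupling of $M_{\mathcal X}$ and $M_{\mathcal Y}$ is bicausal if, for all $n\ge 1$, conditionally on any joint past $(X_0Y_0,\dots,X_{n-1}Y_{n-1})$ of positive probability, $X_n$ has the law that it has under $M_{\mathcal X}$ given $X_0,\dots,X_{n-1}$, and likewise $Y_n$ under $M_{\mathcal Y}$ given $Y_0,\dots,Y_{n-1}$. Put $$\mathbb W_\gamma(M_{\mathcal X},M_{\mathcal Y};c,x_0,y_0)=\inf_{M\text{ bicausal}}\int\sum_{t\ge0}\gamma^t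 c(X_tY_t)\,dM .$$ A transition coupling is a Markov kernel $\pi(x'y'|xy)$ on $\mathcal X\times\mathcal Y$. Let $\mathbb E_\pi$ be the expectation for the chain with kernel $\pi$, with value function $V^\pi(xy)=\mathbb E_\pi[\sum_{t\ge0}\gamma^tc(X_tY_t)\mid X_0Y_0=xy]$ and, for the chain started at $x_0y_0$, occupancy coupling $\mu^\pi(xy,x'y')=(1-\gamma)\mathbb E_\pi[\sum_{t\ge0}\gamma^t\mathbf 1\{X_tY_t=xy,\,X_{t+1}Y_{t+1}=x'y'\}]$. Sinkhorn Value Iteration with exact projections, with parameters $\eta$ and $K\ge1$, started at $\pi_1$, is the following procedure. For odd $k=1,\dots,K-1$, let $V_k$ be a solution of $$V_k(xy,x')=-\frac1\eta\log\sum_{y'}\frac{\pi_k(x'y'|xy)}{P_{\mathcal X}(x'|x)}e^{-\eta Q_k(xy,x'y')},\qquad Q_k(xy,x'y')=c(xy)+\gamma\sum_{x''}P_{\mathcal X}(x''|x')V_k(x'y',x''),$$ and put $$\pi_{k+1}(x'y'|xy)=\frac{\pi_k(x'y'|xy)e^{-\eta Q_k(xy,x'y')}}{\sum_{y''}\pi_k(x'y''|xy)e^{-\eta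 Q_k(xy,x'y'')}}P_{\mathcal X}(x'|x);$$ for even $k$ do the same with the roles of $\mathcal X$ and $\mathcal Y$ exchanged. (The values $V_k(xy,x')$ with $P_{\mathcal X}(x'|x)=0$ play no role, and $\pi_{k+1}(x'y'|xy)=0$ there.) Let $\bar\mu_K=\frac1K\sum_{k=1}^K\mu^{\pi_k}$ and let $\pi_{\bar\mu_K}(x'y'|xy)=\bar\mu_K(xy,x'y')/\sum_{x''y''}\bar\mu_K(xy,x''y'')$, replaced by $P_{\mathcal X}(x'|x)P_{\mathcal Y}(y'|y)$ where the denominator is $0$. The output $\pi_{\rm out}(\cdot|xy)$ is obtained by rounding, for each $xy$, the matrix $F=\pi_{\bar\mu_K}(\cdot|xy)$ to the marginals $p=P_{\mathcal X}(\cdot|x)$, $q=P_{\mathcal Y}(\cdot|y)$: set $F'=\mathrm{diag}(\min(p/(F\mathbf 1),1))F$, $F''=F'\,\mathrm{diag}(\min(q/(F'^{\top}\mathbf 1),1))$, $e_p=p-F''\mathbf 1$, $e_q=q-F''^{\top}\mathbf 1$, and return $F''+e_pe_q^{\top}/\|e_p\|_1$ (and $F''$ if $e_p=0$). Theorem. Let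 $\varepsilon>0$, let $\pi_1(x'y'|xy)=\frac1{|\mathcal X||\mathcal Y|}$ for all $xy,x'y'$, and let $$\eta=\frac1{4\|c\|_\infty}\sqrt{\frac{(1-\gamma)^3\log(|\mathcal X||\mathcal Y|)}{K}} .$$ If the integer $K\ge1$ satisfies $$K\ge\frac{324\,\|c\|_\infty^2\log(|\mathcal X||\mathcal Y|)}{(1-\gamma)^5\varepsilon^2},$$ then the procedure can be carried out (the fixed-point equations have solutions, and all $\pi_k$ and $\pi_{\rm out}$ are transition couplings), and its output always satisfies $$V^{\pi_{\rm out}}(x_0y_0)\le\mathbb W_\gamma(M_{\mathcal X},M_{\mathcal Y};c,x_0,y_0)+\varepsilon .$$ (In the degenerate cases $c=0$ or $|\mathcal X||\mathcal Y|=1$, $\frac10$ is read as $0$ in these formulas.) -/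

import Mathlib

open MeasureTheory ProbabilityTheory

noncomputable section

namespace MarkovOT

/-! ### Markov chains, discounted cost, and the bicausal transport distance -/

section Chains

variable {S : Type*} [Fintype S] [MeasurableSpace S] [MeasurableSingletonClass S]

/-- The probability `P(s' | s)` as a real number. -/
def prob (P : S → PMF S) (s s' : S) : ℝ := (P s s').toReal

/-- The Markov kernel on the finite set `S` with transition probabilities `P(· | s)`. -/
def stepKernel (P : S → PMF S) : Kernel S S :=
  Kernel.ofFunOfCountable fun s => (P s).toMeasure

instance (P : S → PMF S) : IsMarkovKernel (stepKernel P) :=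
  ⟨fun s => PMF.toMeasure.isProbabilityMeasure (P s)⟩

/-- The law on `S^ℕ` of the Markov chain `(S₀, S₁, S₂, …)` that starts at `S₀ = s₀` and has
transition probabilities `P` (given the states at the times `0, …, n`, the state at time `n + 1`
has the law `P(· | S_n)`). -/
def chainLaw (P : S → PMF S) (s₀ : S) : Measure (ℕ → S) :=
  Kernel.traj (X := fun _ => S)
    (fun n => (stepKernel P).comap
      (fun h : ((i : Finset.Iic n) → S) => h ⟨n, Finset.mem_Iic.2 le_rfl⟩)
      (measurable_pi_apply _))
    0 (fun _ => s₀)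

/-- Conditional probability, under the law `M` of a process, of being in `s` at time `n + 1`, given
that the trajectory up to time `n` is `w 0, …, w n`. -/
def condProb (M : Measure (ℕ → S)) (n : ℕ) (w : ℕ → S) (s : S) : ℝ :=
  M.real {ω | (∀ i ≤ n, ω i = w i) ∧ ω (n + 1) = s} / M.real {ω | ∀ i ≤ n, ω i = w i}

/-- Discounted total cost of a trajectory. -/
def discountedCost (c : S → ℝ) (γ : ℝ) (ω : ℕ → S) : ℝ := ∑' t : ℕ, γ ^ t * c (ω t)

/-- The value function `V^π(s) = E_π[∑ₜ γ^t c(S_t) | S₀ = s]`. -/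
def value (c : S → ℝ) (γ : ℝ) (π : S → PMF S) (s : S) : ℝ :=
  ∫ ω, discountedCost c γ ω ∂(chainLaw π s)

/-- The normalized discounted occupancy
`μ^π(s, s') = (1 - γ) E_π[∑ₜ γ^t 1{S_t = s, S_{t+1} = s'}]` of the chain started at `s₀`. -/
def occupancy (γ : ℝ) (s₀ : S) (π : S → PMF S) (s s' : S) : ℝ :=
  (1 - γ) * ∫ ω, (∑' t : ℕ, γ ^ t *
    Set.indicator {ω' : ℕ → S | ω' t = s ∧ ω' (t + 1) = s'} (fun _ => (1 : ℝ)) ω)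
      ∂(chainLaw π s₀)

end Chains

section Transport

variable {X Y : Type*} [Fintype X] [Fintype Y] [MeasurableSpace X] [MeasurableSpace Y]
  [MeasurableSingletonClass X] [MeasurableSingletonClass Y]

/-- `M` is the law of a coupling of the two Markov chains started at `x₀` and `y₀`. -/
def IsCoupling (PX : X → PMF X) (PY : Y → PMF Y) (x₀ : X) (y₀ : Y)
    (M : Measure (ℕ → X × Y)) : Prop :=
  M.map (fun ω t => (ω t).1) = chainLaw PX x₀ ∧ M.map (fun ω t => (ω t).2) = chainLaw PY y₀

/-- A coupling is bicausal if, conditionally on any joint past of positive probability, the next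
state of each chain has the conditional law that it has given that chain's own past. -/
def IsBicausal (PX : X → PMF X) (PY : Y → PMF Y) (x₀ : X) (y₀ : Y)
    (M : Measure (ℕ → X × Y)) : Prop :=
  IsCoupling PX PY x₀ y₀ M ∧
  ∀ (n : ℕ) (w : ℕ → X × Y), M {ω | ∀ i ≤ n, ω i = w i} ≠ 0 →
    (∀ x', ∑ y', condProb M n w (x', y') =
      condProb (chainLaw PX x₀) n (fun i => (w i).1) x') ∧
    (∀ y', ∑ x', condProb M n w (x', y') =
      condProb (chainLaw PY y₀) n (fun i => (w i).2) y')

/-- The bicausal optimal transport distance `W_γ(M_X, M_Y; c, x₀, y₀)`. -/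
def transportDist (PX : X → PMF X) (PY : Y → PMF Y) (c : X × Y → ℝ) (γ : ℝ) (x₀ : X) (y₀ : Y) :
    ℝ :=
  sInf {r : ℝ | ∃ M : Measure (ℕ → X × Y), IsBicausal PX PY x₀ y₀ M ∧
    r = ∫ ω, discountedCost c γ ω ∂M}

end Transport

/-! ### Sinkhorn Value Iteration with exact projections -/

section Algorithm

variable {X Y : Type*} [Fintype X] [Fintype Y]

/-- `Q(xy, x'y')` in a round that projects on the constraints of `X`. -/
def qX (PX : X → PMF X) (c : X × Y → ℝ) (γ : ℝ) (V : X × Y → X → ℝ) (z z' : X × Y) : ℝ :=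
  c z + γ * ∑ x'', prob PX z'.1 x'' * V z' x''

/-- `Q(xy, x'y')` in a round that projects on the constraints of `Y`. -/
def qY (PY : Y → PMF Y) (c : X × Y → ℝ) (γ : ℝ) (V : X × Y → Y → ℝ) (z z' : X × Y) : ℝ :=
  c z + γ * ∑ y'', prob PY z'.2 y'' * V z' y''

/-- The Bellman–Sinkhorn operator for `X`. Its values at `(xy, x')` with `P_X(x' | x) = 0` (where
the formula divides by zero) are `0`; they enter neither `qX` nor `updateX`. -/
def bellmanSinkhornX (PX : X → PMF X) (c : X × Y → ℝ) (γ η : ℝ) (π : X × Y → PMF (X × Y))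
    (V : X × Y → X → ℝ) : X × Y → X → ℝ := fun z x' =>
  -(1 / η) * Real.log (∑ y', prob π z (x', y') / prob PX z.1 x' *
    Real.exp (-η * qX PX c γ V z (x', y')))

/-- The Bellman–Sinkhorn operator for `Y`. -/
def bellmanSinkhornY (PY : Y → PMF Y) (c : X × Y → ℝ) (γ η : ℝ) (π : X × Y → PMF (X × Y))
    (V : X × Y → Y → ℝ) : X × Y → Y → ℝ := fun z y' =>
  -(1 / η) * Real.log (∑ x', prob π z (x', y') / prob PY z.2 y' *
    Real.exp (-η * qY PY c γ V z (x', y')))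

/-- The multiplicative update of the transition coupling in rounds for `X`. -/
def updateX (PX : X → PMF X) (c : X × Y → ℝ) (γ η : ℝ) (π : X × Y → PMF (X × Y))
    (V : X × Y → X → ℝ) (z z' : X × Y) : ℝ :=
  prob π z z' * Real.exp (-η * qX PX c γ V z z') /
    (∑ y'', prob π z (z'.1, y'') * Real.exp (-η * qX PX c γ V z (z'.1, y''))) * prob PX z.1 z'.1

/-- The multiplicative update of the transition coupling in rounds for `Y`. -/
def updateY (PY : Y → PMF Y) (c : X × Y → ℝ) (γ η : ℝ) (π : X × Y → PMF (X × Y))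
    (V : X × Y → Y → ℝ) (z z' : X × Y) : ℝ :=
  prob π z z' * Real.exp (-η * qY PY c γ V z z') /
    (∑ x'', prob π z (x'', z'.2) * Real.exp (-η * qY PY c γ V z (x'', z'.2))) * prob PY z.2 z'.2

/-- `π 1, …, π K` are the iterates of Sinkhorn Value Iteration with exact projections (the
Bellman–Sinkhorn fixed-point equations are solved exactly), started at `π₁`. -/
structure IsSVI (PX : X → PMF X) (PY : Y → PMF Y) (c : X × Y → ℝ) (γ η : ℝ) (K : ℕ)
    (π₁ : X × Y → PMF (X × Y)) (π : ℕ → X × Y → PMF (X × Y)) : Prop where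
  init : π 1 = π₁
  odd_step : ∀ k, 1 ≤ k → k < K → Odd k →
    ∃ V : X × Y → X → ℝ, bellmanSinkhornX PX c γ η (π k) V = V ∧
      ∀ z z', prob (π (k + 1)) z z' = updateX PX c γ η (π k) V z z'
  even_step : ∀ k, 1 ≤ k → k < K → Even k →
    ∃ V : X × Y → Y → ℝ, bellmanSinkhornY PY c γ η (π k) V = V ∧
      ∀ z z', prob (π (k + 1)) z z' = updateY PY c γ η (π k) V z z'

open Classical in
/-- The transition coupling `π_μ` extracted from `μ`. -/
def extract (PX : X → PMF X) (PY : Y → PMF Y) (μ : X × Y → X × Y → ℝ) (z z' : X × Y) : ℝ :=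
  if ∑ z'', μ z z'' ≠ 0 then μ z z' / ∑ z'', μ z z'' else prob PX z.1 z'.1 * prob PY z.2 z'.2

/-- First scaling step of the rounding procedure: `F' = diag(min(p / (F 1), 1)) F`. (A row of zeros
stays a row of zeros, whatever the value of the quotient `p x / 0`.) -/
def roundRows (F : X × Y → ℝ) (p : X → ℝ) (z : X × Y) : ℝ :=
  min (p z.1 / ∑ y, F (z.1, y)) 1 * F z

/-- Second scaling step of the rounding procedure: `F'' = F' diag(min(q / (F'ᵀ 1), 1))`. -/
def roundCols (F : X × Y → ℝ) (q : Y → ℝ) (z : X × Y) : ℝ :=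
  F z * min (q z.2 / ∑ x, F (x, z.2)) 1

/-- The rounding procedure: with `F''` the rescaled matrix and `err_p`, `err_q` its errors in the
two marginals, the output is `F'' + err_p err_qᵀ / ‖err_p‖₁` (and `F''` if `err_p = 0`). -/
def roundCoupling (F : X × Y → ℝ) (p : X → ℝ) (q : Y → ℝ) (z : X × Y) : ℝ :=
  let F'' := roundCols (roundRows F p) q
  let errp : X → ℝ := fun x => p x - ∑ y, F'' (x, y)
  let errq : Y → ℝ := fun y => q y - ∑ x, F'' (x, y)
  F'' z + errp z.1 * errq z.2 / ∑ x, |errp x|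

variable [MeasurableSpace X] [MeasurableSpace Y]
  [MeasurableSingletonClass X] [MeasurableSingletonClass Y]

/-- The average `μ̄_K` of the occupancy couplings of `π 1, …, π K`, for chains started at `z₀`. -/
def avgOccupancy (γ : ℝ) (z₀ : X × Y) (K : ℕ) (π : ℕ → X × Y → PMF (X × Y)) (z z' : X × Y) : ℝ :=
  1 / (K : ℝ) * ∑ k ∈ Finset.Icc 1 K, occupancy γ z₀ (π k) z z'

/-- `πout` is the output of Sinkhorn Value Iteration for the initial state pair `z₀`: the
transition coupling extracted from `μ̄_K`, rounded separately in each state pair. -/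
def IsOutput (PX : X → PMF X) (PY : Y → PMF Y) (γ : ℝ) (z₀ : X × Y) (K : ℕ)
    (π : ℕ → X × Y → PMF (X × Y)) (πout : X × Y → PMF (X × Y)) : Prop :=
  ∀ z z', prob πout z z' =
    roundCoupling (extract PX PY (avgOccupancy γ z₀ K π) z) (prob PX z.1) (prob PY z.2) z'

end Algorithm

end MarkovOT

end

/-! Sinkhorn Value Iteration is mirror descent with alternating entropy projections. The theorem is
a regret bound in which the relative entropy spent in a round pays for the marginal constraint that
the round violates.

A process started at z₀ is replaced by its normalized discounted occupancy, a flow in which the cost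
is linear. The occupancy of a bicausal coupling, Markov or not, has the correct one-step marginals
in both coordinates, and the comparator μs needs nothing more.

Let a round turn π into π'. By the fixed-point equation, log π' - log π = -η (Q - V). Integrated
against a flow with the projected marginal, Q - V telescopes to the cost minus a constant that
depends only on z₀ (`IsFlow.sum_labelQ`). Subtracting this identity for the occupancy μ of π' from
the one for μs gives η (cost μ - cost μs) = ∑ μs log (π'/π) - ∑ μ log (π'/π). The first sum
telescopes over the rounds and stays below log (|X| |Y|), because π₁ is uniform. The second is the
relative entropy of π' with respect to π; by Pinsker's inequality it is at least b times their ℓ¹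
distance minus b², for every b. As π' meets one marginal exactly and π met the other, this distance
bounds the violation of π' (`round_bound`).

Rounding moves at most as much mass as the averaged flow violates (`sum_roundCoupling_extract_le`),
at a price of ‖c‖ / (1 - γ) per unit (`IsFlow.performance`). This dictates b = η ‖c‖ / (1 - γ). The
first two iterates are bounded trivially and add η ‖c‖ + 6 b (`IsSVI.sum_bound`); `suboptimality_le`
inserts the prescribed η. -/

noncomputable section

namespace MarkovOT

/-! ### Laws on trajectories and the Markov property of `chainLaw` -/

section Trajectories

variable {S : Type*} [Fintype S] [MeasurableSpace S] [MeasurableSingletonClass S]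

omit [Fintype S] [MeasurableSingletonClass S] in
lemma measurable_coord (t : ℕ) : Measurable fun ω : ℕ → S => ω t := measurable_pi_apply t

lemma measurableSet_coord (t : ℕ) (A : Set S) : MeasurableSet {ω : ℕ → S | ω t ∈ A} :=
  measurable_coord t (Set.toFinite A).measurableSet

/-- The trajectories that agree with `w` up to time `n`. -/
def past (n : ℕ) (w : ℕ → S) : Set (ℕ → S) := {ω | ∀ i ≤ n, ω i = w i}

omit [Fintype S] in
lemma measurableSet_past (n : ℕ) (w : ℕ → S) : MeasurableSet (past n w) := by
  have : past n w = ⋂ i ∈ Set.Iic n, (fun ω : ℕ → S => ω i) ⁻¹' {w i} := by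
    ext ω; simp [past]
  rw [this]
  exact MeasurableSet.biInter (Set.to_countable _) fun i _ =>
    measurable_pi_apply i (measurableSet_singleton _)

/-- Extension of a finite trajectory. -/
def extendPast (n : ℕ) (u : Fin (n + 1) → S) (i : ℕ) : S := u (Fin.ofNat (n + 1) i)

omit [Fintype S] [MeasurableSpace S] [MeasurableSingletonClass S] in
lemma past_extendPast (n : ℕ) (u : Fin (n + 1) → S) :
    past n (extendPast n u) = (fun (ω : ℕ → S) (i : Fin (n + 1)) => ω i) ⁻¹' {u} := by
  ext ω
  simp only [past, extendPast, Set.mem_ofPred_eq, Set.mem_preimage, Set.mem_singleton_iff]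
  constructor
  · intro h
    ext i
    rw [h i (Nat.lt_succ_iff.1 i.2)]
    congr 1
    ext
    simp
  · rintro rfl i hi
    simp [Nat.mod_eq_of_lt (Nat.lt_succ_iff.2 hi)]

lemma measureReal_eq_sum_past (M : Measure (ℕ → S)) [IsFiniteMeasure M] (n : ℕ)
    (A : Set (ℕ → S)) :
    M.real A = ∑ u : Fin (n + 1) → S, M.real (past n (extendPast n u) ∩ A) := by
  classical
  have h := sum_measureReal_preimage_singleton (μ := M.restrict A) (Finset.univ)
    (f := fun (ω : ℕ → S) (i : Fin (n + 1)) => ω i)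
    (fun u _ => by rw [← past_extendPast]; exact measurableSet_past _ _)
  simp only [Finset.coe_univ, Set.preimage_univ] at h
  rw [measureReal_restrict_apply MeasurableSet.univ, Set.univ_inter] at h
  rw [← h]
  refine Finset.sum_congr rfl fun u _ => ?_
  rw [← past_extendPast, measureReal_restrict_apply (measurableSet_past _ _)]

/-- Two finite measures on trajectories agree if they agree on the sets of trajectories with a given
past. -/
lemma ext_of_past (M N : Measure (ℕ → S)) [IsFiniteMeasure M] [IsFiniteMeasure N]
    (h : ∀ n w, M.real (past n w) = N.real (past n w)) : M = N := by
  have key : ∀ n, M.map (Preorder.frestrictLe (π := fun _ => S) n)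
      = N.map (Preorder.frestrictLe (π := fun _ => S) n) := by
    intro n
    refine Measure.ext_of_singleton fun u => ?_
    rw [Measure.map_apply (Preorder.measurable_frestrictLe n) (measurableSet_singleton _),
      Measure.map_apply (Preorder.measurable_frestrictLe n) (measurableSet_singleton _)]
    have hs : Preorder.frestrictLe (π := fun _ => S) n ⁻¹' {u}
        = past n (fun i => u ⟨min i n, Finset.mem_Iic.2 (min_le_right _ _)⟩) := by
      ext ω
      simp only [past, Set.mem_ofPred_eq, Set.mem_preimage, Set.mem_singleton_iff]
      constructor
      · rintro rfl i hi
        simp [min_eq_left hi]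
      · intro h
        ext i
        rw [Preorder.frestrictLe_apply, h i (Finset.mem_Iic.1 i.2)]
        congr 1
        ext
        simp [Finset.mem_Iic.1 i.2]
    rw [hs]
    exact (ENNReal.toReal_eq_toReal_iff' (measure_ne_top _ _) (measure_ne_top _ _)).1 (h n _)
  have hN : IsProjectiveLimit (α := fun _ : ℕ => S) N (fun I => N.map I.restrict) := fun I => rfl
  refine IsProjectiveLimit.unique (α := fun _ : ℕ => S) (P := fun I => N.map I.restrict)
    (fun I => ?_) hN
  -- Each finite set of times lies in an initial segment, so its marginal is an image of one on
  -- which the measures agree.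
  have hI : I ⊆ Finset.Iic (I.sup id) := I.subset_Iic_sup_id
  have hr : (I.restrict : (ℕ → S) → (I → S)) = Finset.restrict₂ (π := fun _ => S) hI ∘
      Preorder.frestrictLe (π := fun _ => S) (I.sup id) := rfl
  change M.map I.restrict = N.map I.restrict
  rw [hr, ← Measure.map_map (Finset.measurable_restrict₂ _) (Preorder.measurable_frestrictLe _),
    key, Measure.map_map (Finset.measurable_restrict₂ _) (Preorder.measurable_frestrictLe _)]

instance (P : S → PMF S) (s₀ : S) : IsProbabilityMeasure (chainLaw P s₀) := by
  unfold chainLaw; infer_instance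

/-- Restart the trajectory kernel at time n. From a history x it almost surely extends x, so the
past w has conditional probability one if x agrees with w and zero otherwise. In the first case the
next state has law P (w n); integrating over x gives the claim. -/
lemma chainLaw_past_inter (P : S → PMF S) (s₀ : S) (n : ℕ) (w : ℕ → S) (B : Set S) :
    chainLaw P s₀ (past n w ∩ {ω | ω (n + 1) ∈ B})
      = chainLaw P s₀ (past n w) * (P (w n)).toMeasure B := by
  classical
  unfold chainLaw
  set κ : (n : ℕ) → Kernel ((i : Finset.Iic n) → (fun _ => S) i) S :=
    fun n => (stepKernel P).comap
      (fun h : ((i : Finset.Iic n) → S) => h ⟨n, Finset.mem_Iic.2 le_rfl⟩)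
      (measurable_pi_apply _) with hκ
  have hB : MeasurableSet B := (Set.toFinite B).measurableSet
  have hnext : MeasurableSet {ω : ℕ → S | ω (n + 1) ∈ B} := measurableSet_coord _ _
  set v : (i : Finset.Iic n) → S := fun i => w i with hv
  have hpast : past n w = Preorder.frestrictLe (π := fun _ => S) n ⁻¹' {v} := by
    ext ω
    simp only [past, Set.mem_ofPred_eq, Set.mem_preimage, Set.mem_singleton_iff]
    constructor
    · intro h
      ext i
      exact h i (Finset.mem_Iic.1 i.2)
    · intro h i hi
      exact congrFun h ⟨i, Finset.mem_Iic.2 hi⟩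
  have hpm := measurableSet_past n w
  have hdet : ∀ x : (i : Finset.Iic n) → S, ∀ᵐ ω ∂(Kernel.traj (X := fun _ => S) κ n x),
      Preorder.frestrictLe (π := fun _ => S) n ω = x := by
    intro x
    have h := Kernel.traj_map_frestrictLe_of_le (X := fun _ => S) (κ := κ) (le_refl n)
    have h2 : (Kernel.traj (X := fun _ => S) κ n x).map (Preorder.frestrictLe (π := fun _ => S) n)
        = Measure.dirac x := by
      rw [← Kernel.map_apply _ (Preorder.measurable_frestrictLe n), h,
        Kernel.deterministic_apply]
      rfl
    have h3 : ∀ᵐ y ∂((Kernel.traj (X := fun _ => S) κ n x).map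
        (Preorder.frestrictLe (π := fun _ => S) n)), y = x := by
      rw [h2]
      exact (ae_dirac_iff (p := fun y => y = x) (measurableSet_singleton x)).2 rfl
    exact ae_of_ae_map (Preorder.measurable_frestrictLe n).aemeasurable h3
  have hstep : ∀ x : (i : Finset.Iic n) → S,
      Kernel.traj (X := fun _ => S) κ n x (past n w ∩ {ω | ω (n + 1) ∈ B})
        = Kernel.traj (X := fun _ => S) κ n x (past n w) * (P (w n)).toMeasure B := by
    intro x
    by_cases hx : x = v
    · have h1 : ∀ᵐ ω ∂(Kernel.traj (X := fun _ => S) κ n x), ω ∈ past n w := by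
        filter_upwards [hdet x] with ω hω
        rw [hpast, ← hx]
        exact hω
      have h2 : Kernel.traj (X := fun _ => S) κ n x (past n w)ᶜ = 0 := h1
      rw [Set.inter_comm, measure_inter_conull h2,
        (prob_compl_eq_zero_iff hpm).1 h2, one_mul]
      have h4 := Kernel.map_traj_succ_self (X := fun _ => S) (κ := κ) (a := n)
      have h5 := congrArg (fun k => k x B) h4
      rw [Kernel.map_apply _ (by fun_prop), Measure.map_apply (by fun_prop) hB] at h5
      rw [hx] at h5 ⊢
      exact h5
    · have h1 : Kernel.traj (X := fun _ => S) κ n x (past n w) = 0 := by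
        rw [measure_eq_zero_iff_ae_notMem]
        filter_upwards [hdet x] with ω hω
        rw [hpast]
        intro h
        exact hx (hω.symm.trans h)
      rw [h1, zero_mul]
      exact measure_mono_null Set.inter_subset_left h1
  rw [← Kernel.traj_comp_partialTraj (X := fun _ => S) (κ := κ) (Nat.zero_le n),
    Kernel.comp_apply' _ _ _ (hpm.inter hnext), Kernel.comp_apply' _ _ _ hpm]
  simp_rw [hstep]
  rw [lintegral_mul_const _ (Kernel.measurable_coe _ hpm)]

lemma chainLaw_zero (P : S → PMF S) (s₀ : S) : ∀ᵐ ω ∂(chainLaw P s₀), ω 0 = s₀ := by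
  unfold chainLaw
  have h3 : ∀ᵐ y ∂((Kernel.traj (X := fun _ => S) (fun n => (stepKernel P).comap
      (fun h : ((i : Finset.Iic n) → S) => h ⟨n, Finset.mem_Iic.2 le_rfl⟩)
      (measurable_pi_apply _)) 0 (fun _ => s₀)).map
        (Preorder.frestrictLe (π := fun _ => S) 0)), y = fun _ => s₀ := by
    rw [← Kernel.map_apply _ (Preorder.measurable_frestrictLe 0),
      Kernel.traj_map_frestrictLe_of_le (le_refl 0), Kernel.deterministic_apply]
    exact (ae_dirac_iff (p := fun y => y = fun _ => s₀) (measurableSet_singleton _)).2 rfl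
  filter_upwards [ae_of_ae_map (Preorder.measurable_frestrictLe 0).aemeasurable h3] with ω hω
  exact congrFun hω ⟨0, by simp⟩

end Trajectories

/-! ### The Markov property along a label, and discounted occupancies -/

section Trajectories

variable {S L : Type*} [Fintype S] [MeasurableSpace S] [MeasurableSingletonClass S]

/-- Given the past of the process `M`, the label `ℓ` of the next state has the law `p` of the
current state. -/
def IsMarkovAlong (M : Measure (ℕ → S)) (ℓ : S → L) (p : S → L → ℝ) : Prop :=
  ∀ n w l, M.real (past n w ∩ {ω | ℓ (ω (n + 1)) = l}) = M.real (past n w) * p (w n) l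

lemma measureReal_inter_label [DecidableEq L] (M : Measure (ℕ → S)) [IsFiniteMeasure M]
    (A : Set (ℕ → S)) (ℓ : S → L) (t : ℕ) (l : L) :
    M.real (A ∩ {ω | ℓ (ω t) = l}) = ∑ s with ℓ s = l, M.real (A ∩ {ω | ω t = s}) := by
  have hm : ∀ B : Set S, MeasurableSet ((fun ω : ℕ → S => ω t) ⁻¹' B) :=
    fun B => measurableSet_coord t B
  have h := sum_measureReal_preimage_singleton (μ := M.restrict A)
    (Finset.univ.filter fun s => ℓ s = l) (f := fun ω : ℕ → S => ω t) (fun s _ => hm _)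
  simp only [measureReal_restrict_apply (hm _)] at h
  have e1 : ∀ s : S, (fun ω : ℕ → S => ω t) ⁻¹' {s} ∩ A = A ∩ {ω | ω t = s} := by
    intro s; ext ω; simp [and_comm]
  have e2 : (fun ω : ℕ → S => ω t) ⁻¹' ((Finset.univ.filter fun s => ℓ s = l : Finset S) : Set S)
      ∩ A = A ∩ {ω | ℓ (ω t) = l} := by
    ext ω; simp [and_comm]
  simp only [e1, e2] at h
  exact h.symm

lemma sum_measureReal_inter (M : Measure (ℕ → S)) [IsFiniteMeasure M]
    (A : Set (ℕ → S)) (t : ℕ) :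
    ∑ s, M.real (A ∩ {ω | ω t = s}) = M.real A := by
  have h := measureReal_inter_label M A (fun _ : S => ()) t ()
  simp at h
  exact h.symm

lemma IsMarkovAlong.label [DecidableEq L] {M : Measure (ℕ → S)} [IsFiniteMeasure M]
    {p : S → S → ℝ} (h : IsMarkovAlong M id p) (ℓ : S → L) :
    IsMarkovAlong M ℓ (fun s l => ∑ s' with ℓ s' = l, p s s') := by
  intro n w l
  rw [measureReal_inter_label, Finset.mul_sum]
  exact Finset.sum_congr rfl fun s' _ => h n w s'

/-- The Markov property for an event that is determined by the states up to time `n`. -/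
lemma IsMarkovAlong.measureReal_inter {M : Measure (ℕ → S)} [IsFiniteMeasure M] {ℓ : S → L}
    {p : S → L → ℝ} (h : IsMarkovAlong M ℓ p) (n : ℕ) (A : Set (ℕ → S))
    (hA : ∀ ω ω' : ℕ → S, (∀ i ≤ n, ω i = ω' i) → ω ∈ A → ω' ∈ A) (l : L) (q : ℝ)
    (hq : ∀ ω ∈ A, p (ω n) l = q) :
    M.real (A ∩ {ω | ℓ (ω (n + 1)) = l}) = M.real A * q := by
  rw [measureReal_eq_sum_past M n, measureReal_eq_sum_past M n A, Finset.sum_mul]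
  refine Finset.sum_congr rfl fun u _ => ?_
  set w := extendPast n u
  -- A past up to time n lies inside A or is disjoint from it.
  by_cases hw : w ∈ A
  · have e1 : past n w ∩ A = past n w :=
      Set.inter_eq_left.2 fun ω hω => hA w ω (fun i hi => (hω i hi).symm) hw
    rw [← Set.inter_assoc, e1, h n w l, hq w hw]
  · have e1 : past n w ∩ A = ∅ := by
      rw [Set.eq_empty_iff_forall_notMem]
      rintro ω ⟨h1, h2⟩
      exact hw (hA ω w h1 h2)
    rw [← Set.inter_assoc, e1]
    simp

omit [Fintype S] in
lemma toMeasure_singleton (P : S → PMF S) (s s' : S) :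
    ((P s).toMeasure {s'}).toReal = prob P s s' := by
  rw [PMF.toMeasure_apply_singleton _ _ (measurableSet_singleton _), prob]

lemma isMarkovAlong_chainLaw (P : S → PMF S) (s₀ : S) :
    IsMarkovAlong (chainLaw P s₀) id (prob P) := by
  intro n w s
  have h := congrArg ENNReal.toReal (chainLaw_past_inter P s₀ n w {s})
  rw [ENNReal.toReal_mul, toMeasure_singleton] at h
  exact h

omit [Fintype S] [MeasurableSpace S] [MeasurableSingletonClass S] in
lemma past_succ (n : ℕ) (w : ℕ → S) :
    past (n + 1) w = past n w ∩ {ω | id (ω (n + 1)) = w (n + 1)} := by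
  ext ω
  constructor
  · intro h
    exact ⟨fun i hi => h i (Nat.le_succ_of_le hi), h _ le_rfl⟩
  · rintro ⟨h1, h2⟩ i hi
    rcases Nat.le_succ_iff.1 hi with hi | rfl
    · exact h1 i hi
    · exact h2

lemma eq_of_isMarkovAlong {M N : Measure (ℕ → S)} [IsProbabilityMeasure M]
    [IsProbabilityMeasure N] {p : S → S → ℝ} {s₀ : S}
    (hM : IsMarkovAlong M id p) (hN : IsMarkovAlong N id p)
    (hM₀ : ∀ᵐ ω ∂M, ω 0 = s₀) (hN₀ : ∀ᵐ ω ∂N, ω 0 = s₀) : M = N := by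
  classical
  have h0 : ∀ (Q : Measure (ℕ → S)) [IsProbabilityMeasure Q], (∀ᵐ ω ∂Q, ω 0 = s₀) → ∀ w : ℕ → S,
      Q.real (past 0 w) = if w 0 = s₀ then 1 else 0 := by
    intro Q _ hQ w
    split_ifs with hw
    · have : Q (past 0 w)ᶜ = 0 := by
        rw [measure_eq_zero_iff_ae_notMem]
        filter_upwards [hQ] with ω h hω
        refine hω fun i hi => ?_
        rw [Nat.le_zero.1 hi, hw]
        exact h
      rw [measureReal_def, (prob_compl_eq_zero_iff (measurableSet_past 0 w)).1 this]
      rfl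
    · have : Q (past 0 w) = 0 := by
        rw [measure_eq_zero_iff_ae_notMem]
        filter_upwards [hQ] with ω h hω
        refine hw ?_
        rw [← h]
        exact (hω 0 le_rfl).symm
      rw [measureReal_def, this]
      rfl
  refine ext_of_past M N fun n w => ?_
  induction n with
  | zero => rw [h0 M hM₀, h0 N hN₀]
  | succ n ih => rw [past_succ, hM, hN, ih]

/-- The discounted probability that the process is in the state `s`. -/
def discountedState (γ : ℝ) (M : Measure (ℕ → S)) (s : S) : ℝ :=
  (1 - γ) * ∑' t : ℕ, γ ^ t * M.real {ω | ω t = s}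

/-- The normalized discounted occupancy of a process. -/
def discountedPair (γ : ℝ) (M : Measure (ℕ → S)) (s s' : S) : ℝ :=
  (1 - γ) * ∑' t : ℕ, γ ^ t * M.real ({ω | ω t = s} ∩ {ω | ω (t + 1) = s'})

lemma summable_discounted {γ : ℝ} (hγ₀ : 0 ≤ γ) (hγ₁ : γ < 1) {a : ℕ → ℝ} {C : ℝ}
    (ha : ∀ t, |a t| ≤ C) : Summable fun t => γ ^ t * a t := by
  refine Summable.of_norm_bounded ((summable_geometric_of_lt_one hγ₀ hγ₁).mul_right C)
    fun t => ?_
  rw [norm_mul, Real.norm_eq_abs, Real.norm_eq_abs, abs_of_nonneg (pow_nonneg hγ₀ t)]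
  exact mul_le_mul_of_nonneg_left (ha t) (pow_nonneg hγ₀ t)

omit [Fintype S] [MeasurableSingletonClass S] in
lemma abs_measureReal_le_one (M : Measure (ℕ → S)) [IsProbabilityMeasure M] (A : Set (ℕ → S)) :
    |M.real A| ≤ 1 := by
  rw [abs_of_nonneg measureReal_nonneg]
  exact measureReal_le_one

-- The uniform bound on `g` gives a geometric majorant, which justifies the exchange.
omit [Fintype S] [MeasurableSingletonClass S] in
lemma integral_discounted (M : Measure (ℕ → S)) [IsProbabilityMeasure M]
    {γ : ℝ} (hγ₀ : 0 ≤ γ) (hγ₁ : γ < 1) (g : ℕ → (ℕ → S) → ℝ) (hg : ∀ t, Measurable (g t))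
    {C : ℝ} (hC : ∀ t ω, |g t ω| ≤ C) :
    ∫ ω, ∑' t : ℕ, γ ^ t * g t ω ∂M = ∑' t : ℕ, γ ^ t * ∫ ω, g t ω ∂M := by
  have hint : ∀ t, Integrable (g t) M := fun t =>
    Integrable.of_bound (hg t).aestronglyMeasurable C (ae_of_all _ fun ω => hC t ω)
  rw [← integral_tsum_of_summable_integral_norm (fun t => (hint t).const_mul (γ ^ t))]
  · simp_rw [integral_const_mul]
  · simp_rw [norm_mul, integral_const_mul, Real.norm_eq_abs, abs_of_nonneg (pow_nonneg hγ₀ _)]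
    refine summable_discounted hγ₀ hγ₁ (C := C) fun t => ?_
    rw [abs_of_nonneg (integral_nonneg fun _ => abs_nonneg _)]
    calc ∫ ω, |g t ω| ∂M ≤ ∫ _, C ∂M :=
          integral_mono (hint t).abs (integrable_const C) fun ω => hC t ω
      _ = C := by simp

omit [Fintype S] [MeasurableSingletonClass S] in
lemma discountedPair_nonneg {γ : ℝ} (hγ₀ : 0 ≤ γ) (hγ₁ : γ < 1) (M : Measure (ℕ → S)) (s s' : S) :
    0 ≤ discountedPair γ M s s' :=
  mul_nonneg (by linarith) (tsum_nonneg fun t => mul_nonneg (pow_nonneg hγ₀ t) measureReal_nonneg)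

lemma sum_discountedPair_label [DecidableEq L] {γ : ℝ} (hγ₀ : 0 ≤ γ) (hγ₁ : γ < 1)
    (M : Measure (ℕ → S)) [IsProbabilityMeasure M] (ℓ : S → L) (s : S) (l : L) :
    ∑ s' with ℓ s' = l, discountedPair γ M s s' = (1 - γ) * ∑' t : ℕ, γ ^ t *
      M.real ({ω | ω t = s} ∩ {ω | ℓ (ω (t + 1)) = l}) := by
  simp_rw [discountedPair, ← Finset.mul_sum]
  rw [← Summable.tsum_finsetSum fun s' _ =>
    summable_discounted hγ₀ hγ₁ fun t => abs_measureReal_le_one M _]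
  simp_rw [← Finset.mul_sum, measureReal_inter_label]

lemma sum_discountedPair {γ : ℝ} (hγ₀ : 0 ≤ γ) (hγ₁ : γ < 1)
    (M : Measure (ℕ → S)) [IsProbabilityMeasure M] (s : S) :
    ∑ s', discountedPair γ M s s' = discountedState γ M s := by
  have h := sum_discountedPair_label hγ₀ hγ₁ M (fun _ => ()) s ()
  simpa [discountedState] using h

lemma IsMarkovAlong.sum_discountedPair [DecidableEq L] {γ : ℝ} (hγ₀ : 0 ≤ γ) (hγ₁ : γ < 1)
    {M : Measure (ℕ → S)} [IsProbabilityMeasure M] {ℓ : S → L} {p : S → L → ℝ}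
    (h : IsMarkovAlong M ℓ p) (s : S) (l : L) :
    ∑ s' with ℓ s' = l, discountedPair γ M s s' = (∑ s', discountedPair γ M s s') * p s l := by
  rw [sum_discountedPair_label hγ₀ hγ₁, MarkovOT.sum_discountedPair hγ₀ hγ₁, discountedState,
    mul_assoc, ← tsum_mul_right]
  congr 1
  refine tsum_congr fun t => ?_
  rw [h.measureReal_inter t _ _ l (p s l), mul_assoc]
  · rintro ω rfl
    rfl
  · intro ω ω' hω h
    exact (hω t le_rfl).symm.trans h

/-- The term t = 0 contributes the initial law; after a shift of time the others are γ times the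
second marginal of the occupancy. -/
lemma discountedState_flow {γ : ℝ} (hγ₀ : 0 ≤ γ) (hγ₁ : γ < 1)
    (M : Measure (ℕ → S)) [IsProbabilityMeasure M] (s : S) :
    ∑ s', discountedPair γ M s s'
      = γ * ∑ s', discountedPair γ M s' s + (1 - γ) * M.real {ω | ω 0 = s} := by
  rw [sum_discountedPair hγ₀ hγ₁, discountedState,
    (summable_discounted hγ₀ hγ₁ fun t => abs_measureReal_le_one M _).tsum_eq_zero_add]
  simp_rw [discountedPair, ← Finset.mul_sum]
  rw [← Summable.tsum_finsetSum fun s' _ =>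
    summable_discounted hγ₀ hγ₁ fun t => abs_measureReal_le_one M _]
  have hswap : ∀ t s', M.real ({ω | ω t = s'} ∩ {ω | ω (t + 1) = s})
      = M.real ({ω | ω (t + 1) = s} ∩ {ω | ω t = s'}) := fun t s' => by rw [Set.inter_comm]
  simp only [← Finset.mul_sum, hswap, sum_measureReal_inter]
  rw [pow_zero, one_mul, mul_add, add_comm, mul_left_comm γ, ← tsum_mul_left]
  simp_rw [pow_succ', mul_assoc, tsum_mul_left]

lemma integral_discountedCost {γ : ℝ} (hγ₀ : 0 ≤ γ) (hγ₁ : γ < 1)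
    (M : Measure (ℕ → S)) [IsProbabilityMeasure M] (c : S → ℝ) :
    (1 - γ) * ∫ ω, discountedCost c γ ω ∂M = ∑ s, ∑ s', discountedPair γ M s s' * c s := by
  simp_rw [← Finset.sum_mul, sum_discountedPair hγ₀ hγ₁]
  have hm : ∀ t, Measurable fun ω : ℕ → S => c (ω t) := fun t =>
    (measurable_of_finite c).comp (measurable_coord t)
  unfold discountedCost
  rw [integral_discounted M hγ₀ hγ₁ (fun t ω => c (ω t)) hm (C := ‖c‖)
    fun t ω => norm_le_pi_norm c _]
  simp_rw [discountedState, mul_assoc, ← Finset.mul_sum, ← tsum_mul_right]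
  rw [← Summable.tsum_finsetSum]
  · congr 1
    refine tsum_congr fun t => ?_
    simp_rw [mul_assoc, ← Finset.mul_sum]
    congr 1
    have h1 : ∫ ω, c (ω t) ∂M = ∫ s, c s ∂(M.map fun ω => ω t) :=
      (integral_map (measurable_coord t).aemeasurable
        (measurable_of_finite c).aestronglyMeasurable).symm
    rw [h1, integral_fintype (Integrable.of_finite)]
    refine Finset.sum_congr rfl fun s _ => ?_
    rw [map_measureReal_apply (measurable_coord t) (measurableSet_singleton s), smul_eq_mul]
    rfl
  · intro s _
    exact (summable_discounted hγ₀ hγ₁ fun t => abs_measureReal_le_one M _).mul_right _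

lemma occupancy_eq {γ : ℝ} (hγ₀ : 0 ≤ γ) (hγ₁ : γ < 1) (s₀ : S) (π : S → PMF S) (s s' : S) :
    occupancy γ s₀ π s s' = discountedPair γ (chainLaw π s₀) s s' := by
  have hms : ∀ t, MeasurableSet {ω : ℕ → S | ω t = s ∧ ω (t + 1) = s'} := fun t =>
    (measurableSet_coord t {s}).inter (measurableSet_coord (t + 1) {s'})
  unfold occupancy discountedPair
  rw [integral_discounted _ hγ₀ hγ₁ _ (fun t => measurable_const.indicator (hms t)) (C := 1)]
  · congr 1
    refine tsum_congr fun t => ?_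
    rw [integral_indicator_const _ (hms t), smul_eq_mul, mul_one]
    rfl
  · intro t ω
    rcases Set.indicator_eq_zero_or_self {ω' : ℕ → S | ω' t = s ∧ ω' (t + 1) = s'}
      (fun _ => (1 : ℝ)) ω with h | h <;> simp [h]

end Trajectories

/-! ### Discounted flows and multiplicative updates -/

section Flow

variable {Z L : Type*} [Fintype Z] [Fintype L] [DecidableEq L]

/-- `μ` is a discounted flow that starts at `z₀`; the flow equation is stated in its dual form. -/
structure IsFlow (γ : ℝ) (z₀ : Z) (μ : Z → Z → ℝ) : Prop where
  nonneg : ∀ z z', 0 ≤ μ z z'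
  dual : ∀ g : Z → ℝ, ∑ z, ∑ z', μ z z' * (g z - γ * g z') = (1 - γ) * g z₀

/-- Under `μ`, the label `ℓ` of the second state has the law `p` given the first state. -/
def HasLabelLaw (ℓ : Z → L) (p : Z → L → ℝ) (μ : Z → Z → ℝ) : Prop :=
  ∀ z l, ∑ z' with ℓ z' = l, μ z z' = (∑ z', μ z z') * p z l

/-- The total deviation of the law of the label from `p`. -/
def labelError (ℓ : Z → L) (p : Z → L → ℝ) (μ : Z → Z → ℝ) : ℝ :=
  ∑ z, ∑ l, |∑ z' with ℓ z' = l, μ z z' - (∑ z', μ z z') * p z l|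

/-- The expected cost of `μ`. -/
def flowCost (c : Z → ℝ) (μ : Z → Z → ℝ) : ℝ := ∑ z, ∑ z', μ z z' * c z

/-- The state-action value of a label-dependent value function. -/
def labelQ (p : Z → L → ℝ) (c : Z → ℝ) (γ : ℝ) (V : Z → L → ℝ) (z z' : Z) : ℝ :=
  c z + γ * ∑ l, p z' l * V z' l

/-- The Bellman–Sinkhorn operator for the constraints on the label. -/
def bellmanSinkhorn (ℓ : Z → L) (p : Z → L → ℝ) (c : Z → ℝ) (γ η : ℝ) (π : Z → Z → ℝ)
    (V : Z → L → ℝ) (z : Z) (l : L) : ℝ :=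
  -(1 / η) * Real.log (∑ z' with ℓ z' = l, π z z' / p z l * Real.exp (-η * labelQ p c γ V z z'))

/-- The multiplicative update for the constraints on the label. -/
def labelUpdate (ℓ : Z → L) (p : Z → L → ℝ) (c : Z → ℝ) (γ η : ℝ) (π : Z → Z → ℝ)
    (V : Z → L → ℝ) (z z' : Z) : ℝ :=
  π z z' * Real.exp (-η * labelQ p c γ V z z') /
    (∑ z'' with ℓ z'' = ℓ z', π z z'' * Real.exp (-η * labelQ p c γ V z z'')) * p z (ℓ z')

lemma IsFlow.sum_eq_one {γ : ℝ} {z₀ : Z} {μ : Z → Z → ℝ} (h : IsFlow γ z₀ μ) (hγ₁ : γ < 1) :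
    ∑ z, ∑ z', μ z z' = 1 := by
  have := h.dual fun _ => 1
  simp only [mul_one, ← Finset.sum_mul] at this
  have h1 : (0 : ℝ) < 1 - γ := by linarith
  field_simp at this
  exact this

lemma sum_label (f : Z → ℝ) (ℓ : Z → L) : ∑ l, ∑ z with ℓ z = l, f z = ∑ z, f z :=
  Finset.sum_fiberwise _ _ _

lemma sum_mul_label (f : Z → ℝ) (ℓ : Z → L) (g : L → ℝ) :
    ∑ z, f z * g (ℓ z) = ∑ l, (∑ z with ℓ z = l, f z) * g l := by
  rw [← sum_label _ ℓ]
  refine Finset.sum_congr rfl fun l _ => ?_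
  rw [Finset.sum_mul]
  refine Finset.sum_congr rfl fun z hz => ?_
  rw [(Finset.mem_filter.1 hz).2]

/-- The label law averages V z (ℓ z') to g z = ∑ p z l * V z l, and the flow equation tested with g
telescopes. The value term left over does not depend on μ, so it cancels when two flows are
compared. -/
lemma IsFlow.sum_labelQ {γ : ℝ} {z₀ : Z} {μ : Z → Z → ℝ} (h : IsFlow γ z₀ μ) {ℓ : Z → L}
    {p : Z → L → ℝ} (hp : HasLabelLaw ℓ p μ) (c : Z → ℝ) (V : Z → L → ℝ) :
    ∑ z, ∑ z', μ z z' * (labelQ p c γ V z z' - V z (ℓ z'))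
      = flowCost c μ - (1 - γ) * ∑ l, p z₀ l * V z₀ l := by
  have h1 := h.dual fun z => ∑ l, p z l * V z l
  have h2 : ∀ z, ∑ z', μ z z' * V z (ℓ z') = ∑ z', μ z z' * ∑ l, p z l * V z l := by
    intro z
    rw [sum_mul_label (μ z) ℓ (V z), ← Finset.sum_mul, Finset.mul_sum]
    refine Finset.sum_congr rfl fun l _ => ?_
    rw [hp z l, mul_assoc]
  rw [← h1, flowCost, ← Finset.sum_sub_distrib]
  refine Finset.sum_congr rfl fun z _ => ?_
  simp only [mul_sub, Finset.sum_sub_distrib, h2, labelQ, mul_add, Finset.sum_add_distrib]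
  ring

omit [Fintype L] in
lemma HasLabelLaw.pos {ℓ : Z → L} {p : Z → L → ℝ} {μ : Z → Z → ℝ} (h : HasLabelLaw ℓ p μ)
    (hμ : ∀ z z', 0 ≤ μ z z') {z z' : Z} (hz : 0 < μ z z') : 0 < p z (ℓ z') := by
  have h1 : 0 < ∑ z'' with ℓ z'' = ℓ z', μ z z'' :=
    Finset.sum_pos' (fun _ _ => hμ _ _) ⟨z', by simp, hz⟩
  rw [h] at h1
  exact pos_of_mul_pos_right h1 (Finset.sum_nonneg fun _ _ => hμ _ _)

lemma labelError_eq_zero {ℓ : Z → L} {p : Z → L → ℝ} {μ : Z → Z → ℝ} (h : HasLabelLaw ℓ p μ) :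
    labelError ℓ p μ = 0 := by
  refine Finset.sum_eq_zero fun z _ => Finset.sum_eq_zero fun l _ => ?_
  rw [h, sub_self, abs_zero]

/-- The trivial bound, for use where no preceding iterate is known to meet the constraint. -/
lemma labelError_le_two {γ : ℝ} {z₀ : Z} {μ : Z → Z → ℝ} (h : IsFlow γ z₀ μ) (hγ₁ : γ < 1)
    (ℓ : Z → L) {p : Z → L → ℝ} (hp₀ : ∀ z l, 0 ≤ p z l) (hp : ∀ z, ∑ l, p z l = 1) :
    labelError ℓ p μ ≤ 2 := by
  have h0 : ∀ z l, |∑ z' with ℓ z' = l, μ z z' - (∑ z', μ z z') * p z l|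
      ≤ ∑ z' with ℓ z' = l, μ z z' + (∑ z', μ z z') * p z l := by
    intro z l
    have h1 : 0 ≤ ∑ z' with ℓ z' = l, μ z z' := Finset.sum_nonneg fun _ _ => h.nonneg _ _
    have h2 : 0 ≤ (∑ z', μ z z') * p z l :=
      mul_nonneg (Finset.sum_nonneg fun _ _ => h.nonneg _ _) (hp₀ _ _)
    rw [abs_le]
    constructor <;> linarith
  calc labelError ℓ p μ
      ≤ ∑ z, ∑ l, (∑ z' with ℓ z' = l, μ z z' + (∑ z', μ z z') * p z l) :=
        Finset.sum_le_sum fun z _ => Finset.sum_le_sum fun l _ => h0 z l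
    _ = ∑ z, (∑ z', μ z z' + ∑ z', μ z z') := by
        refine Finset.sum_congr rfl fun z _ => ?_
        rw [Finset.sum_add_distrib, sum_label, ← Finset.mul_sum, hp, mul_one]
    _ = 2 := by rw [Finset.sum_add_distrib, h.sum_eq_one hγ₁]; norm_num

lemma flowCost_nonneg {c : Z → ℝ} (hc : ∀ z, 0 ≤ c z) {γ : ℝ} {z₀ : Z} {μ : Z → Z → ℝ}
    (h : IsFlow γ z₀ μ) : 0 ≤ flowCost c μ :=
  Finset.sum_nonneg fun _ _ => Finset.sum_nonneg fun _ _ => mul_nonneg (h.nonneg _ _) (hc _)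

lemma flowCost_le {c : Z → ℝ} {C : ℝ} (hc : ∀ z, c z ≤ C) {γ : ℝ} (hγ₁ : γ < 1) {z₀ : Z}
    {μ : Z → Z → ℝ} (h : IsFlow γ z₀ μ) : flowCost c μ ≤ C := by
  calc flowCost c μ ≤ ∑ z, ∑ z', μ z z' * C :=
        Finset.sum_le_sum fun _ _ => Finset.sum_le_sum fun _ _ =>
          mul_le_mul_of_nonneg_left (hc _) (h.nonneg _ _)
    _ = C := by simp_rw [← Finset.sum_mul]; rw [h.sum_eq_one hγ₁, one_mul]

/-! #### The update -/

variable {ℓ : Z → L} {p : Z → L → ℝ} {c : Z → ℝ} {γ η : ℝ} {π : Z → Z → ℝ} {V : Z → L → ℝ}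

lemma labelUpdate_nonneg (hπ : ∀ z z', 0 ≤ π z z') (hp : ∀ z l, 0 ≤ p z l) (z z' : Z) :
    0 ≤ labelUpdate ℓ p c γ η π V z z' :=
  mul_nonneg (div_nonneg (mul_nonneg (hπ _ _) (Real.exp_nonneg _))
    (Finset.sum_nonneg fun _ _ => mul_nonneg (hπ _ _) (Real.exp_nonneg _))) (hp _ _)

lemma sum_exp_pos (hπ : ∀ z z', 0 ≤ π z z') {z z' : Z} (hz : 0 < π z z') :
    0 < ∑ z'' with ℓ z'' = ℓ z', π z z'' * Real.exp (-η * labelQ p c γ V z z'') :=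
  Finset.sum_pos' (fun _ _ => mul_nonneg (hπ _ _) (Real.exp_nonneg _))
    ⟨z', by simp, mul_pos hz (Real.exp_pos _)⟩

lemma labelUpdate_pos (hπ : ∀ z z', 0 ≤ π z z') {z z' : Z} (hz : 0 < π z z')
    (hp : 0 < p z (ℓ z')) : 0 < labelUpdate ℓ p c γ η π V z z' :=
  mul_pos (div_pos (mul_pos hz (Real.exp_pos _)) (sum_exp_pos hπ hz)) hp

lemma pos_of_labelUpdate_pos (hπ : ∀ z z', 0 ≤ π z z') {z z' : Z}
    (hz : labelUpdate ℓ p c γ η π V z z' ≠ 0) : 0 < π z z' := by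
  refine (hπ z z').lt_of_ne fun h => hz ?_
  rw [labelUpdate, ← h, zero_mul, zero_div, zero_mul]

/-- The hypothesis `hpos` is essential: if π charged no state with an allowed label, the
normalization would be a division by zero and the mass of that label would be lost. -/
lemma sum_labelUpdate (hπ : ∀ z z', 0 ≤ π z z') {z : Z}
    (hpos : ∀ l, p z l ≠ 0 → ∃ z', ℓ z' = l ∧ 0 < π z z') (l : L) :
    ∑ z' with ℓ z' = l, labelUpdate ℓ p c γ η π V z z' = p z l := by
  by_cases hl : p z l = 0
  · rw [hl]
    refine Finset.sum_eq_zero fun z' hz' => ?_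
    rw [labelUpdate, (Finset.mem_filter.1 hz').2, hl, mul_zero]
  · obtain ⟨z₁, rfl, h1⟩ := hpos l hl
    have h2 := sum_exp_pos (ℓ := ℓ) (p := p) (c := c) (γ := γ) (η := η) (V := V) hπ h1
    have h3 : ∀ z' ∈ Finset.univ.filter (fun z' => ℓ z' = ℓ z₁),
        labelUpdate ℓ p c γ η π V z z' = π z z' * Real.exp (-η * labelQ p c γ V z z') *
        ((∑ z'' with ℓ z'' = ℓ z₁, π z z'' * Real.exp (-η * labelQ p c γ V z z''))⁻¹
          * p z (ℓ z₁)) := by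
      intro z' hz'
      rw [labelUpdate, (Finset.mem_filter.1 hz').2]
      ring
    rw [Finset.sum_congr rfl h3, ← Finset.sum_mul, ← mul_assoc, mul_inv_cancel₀ h2.ne', one_mul]

/-- At a fixed point, η V is minus the logarithm of the normalizing factor of the update, so that π'
= π exp (-η (Q - V)). -/
lemma log_labelUpdate (hη : η ≠ 0) (hπ : ∀ z z', 0 ≤ π z z')
    (hV : bellmanSinkhorn ℓ p c γ η π V = V) {z z' : Z} (hz : 0 < π z z')
    (hp : 0 < p z (ℓ z')) :
    Real.log (labelUpdate ℓ p c γ η π V z z') - Real.log (π z z')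
      = -η * (labelQ p c γ V z z' - V z (ℓ z')) := by
  have hS := sum_exp_pos (ℓ := ℓ) (p := p) (c := c) (γ := γ) (η := η) (V := V) hπ hz
  have h1 : η * V z (ℓ z') = -Real.log ((∑ z'' with ℓ z'' = ℓ z', π z z'' *
      Real.exp (-η * labelQ p c γ V z z'')) / p z (ℓ z')) := by
    conv_lhs => rw [← hV]
    rw [bellmanSinkhorn, Finset.sum_div]
    simp_rw [div_mul_eq_mul_div]
    field_simp
  rw [Real.log_div hS.ne' hp.ne'] at h1
  rw [labelUpdate, Real.log_mul (div_pos (mul_pos hz (Real.exp_pos _)) hS).ne' hp.ne',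
    Real.log_div (mul_pos hz (Real.exp_pos _)).ne' hS.ne', Real.log_mul hz.ne' (Real.exp_ne_zero _),
    Real.log_exp]
  linarith

lemma IsFlow.sum_log_labelUpdate {z₀ : Z} {μ : Z → Z → ℝ} (h : IsFlow γ z₀ μ)
    (hμ : HasLabelLaw ℓ p μ) (hη : η ≠ 0) (hπ : ∀ z z', 0 ≤ π z z')
    (hV : bellmanSinkhorn ℓ p c γ η π V = V) (hs : ∀ z z', 0 < μ z z' → 0 < π z z') :
    ∑ z, ∑ z', μ z z' * (Real.log (labelUpdate ℓ p c γ η π V z z') - Real.log (π z z'))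
      = -η * (flowCost c μ - (1 - γ) * ∑ l, p z₀ l * V z₀ l) := by
  rw [← h.sum_labelQ hμ, Finset.mul_sum]
  refine Finset.sum_congr rfl fun z _ => ?_
  rw [Finset.mul_sum]
  refine Finset.sum_congr rfl fun z' _ => ?_
  rcases (h.nonneg z z').eq_or_lt with h0 | h0
  · rw [← h0]; ring
  · rw [log_labelUpdate hη hπ hV (hs z z' h0) (hμ.pos h.nonneg h0)]
    ring

/-- Pointwise Pinsker through the Hellinger distance: with a = x² and b = y², the entropy term is at
least (x - y)², while |a - b| = |x - y| (x + y). -/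
lemma mul_abs_sub_le {a b t : ℝ} (ha : 0 ≤ a) (hb : 0 ≤ b) (hab : 0 < a → 0 < b) :
    t * |a - b| ≤ a * (Real.log a - Real.log b) - a + b + t ^ 2 * (a + b) / 2 := by
  obtain ⟨x, hx, rfl⟩ : ∃ x, 0 ≤ x ∧ a = x ^ 2 := ⟨√a, Real.sqrt_nonneg _, (Real.sq_sqrt ha).symm⟩
  obtain ⟨y, hy, rfl⟩ : ∃ y, 0 ≤ y ∧ b = y ^ 2 := ⟨√b, Real.sqrt_nonneg _, (Real.sq_sqrt hb).symm⟩
  have h1 : 2 * x ^ 2 - 2 * x * y ≤ x ^ 2 * (Real.log (x ^ 2) - Real.log (y ^ 2)) := by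
    rcases hx.eq_or_lt with rfl | hx'
    · simp
    · have hy' : 0 < y := by
        have := hab (by positivity)
        exact hy.lt_of_ne fun h => by simp [← h] at this
      have h2 := Real.log_le_sub_one_of_pos (div_pos hy' hx')
      rw [Real.log_div hy'.ne' hx'.ne'] at h2
      rw [Real.log_pow, Real.log_pow]
      push_cast
      have h3 : x ^ 2 * (Real.log y - Real.log x) ≤ x ^ 2 * (y / x - 1) :=
        mul_le_mul_of_nonneg_left h2 (sq_nonneg x)
      have h4 : x ^ 2 * (y / x - 1) = x * y - x ^ 2 := by field_simp
      nlinarith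
  have h5 : |x ^ 2 - y ^ 2| = |x - y| * (x + y) := by
    rw [show x ^ 2 - y ^ 2 = (x - y) * (x + y) by ring, abs_mul, abs_of_nonneg (add_nonneg hx hy)]
  rw [h5]
  have h6 := sq_abs (x - y)
  -- Young's inequality t |x - y| (x + y) ≤ (x - y)² + t² (x + y)² / 4, followed by (x + y)² ≤ 2 (x²
  -- + y²).
  nlinarith [sq_nonneg (|x - y| - t * (x + y) / 2), mul_nonneg (sq_nonneg t) (sq_nonneg (x - y))]

/-- A form of Pinsker's inequality. -/
lemma mul_sum_abs_sub_le {f g : Z → ℝ} (hf : ∀ z, 0 ≤ f z) (hg : ∀ z, 0 ≤ g z)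
    (hfg : ∀ z, 0 < f z → 0 < g z) (hf₁ : ∑ z, f z = 1) (hg₁ : ∑ z, g z = 1) (t : ℝ) :
    t * ∑ z, |f z - g z| ≤ ∑ z, f z * (Real.log (f z) - Real.log (g z)) + t ^ 2 := by
  have h := Finset.sum_le_sum fun z (_ : z ∈ Finset.univ) =>
    mul_abs_sub_le (t := t) (hf z) (hg z) (hfg z)
  simp only [Finset.sum_add_distrib, Finset.sum_sub_distrib, ← Finset.mul_sum, ← Finset.sum_div,
    hf₁, hg₁] at h
  linarith

/-! #### Solutions of the fixed-point equations -/

lemma exists_fixedPoint_of_contraction {ι : Type*} [Fintype ι] {γ : ℝ} (hγ₀ : 0 ≤ γ) (hγ₁ : γ < 1)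
    (T : (ι → ℝ) → ι → ℝ)
    (hT : ∀ U V : ι → ℝ, ∀ δ : ℝ, (∀ i, |U i - V i| ≤ δ) → 0 ≤ δ → ∀ i, |T U i - T V i| ≤ γ * δ) :
    ∃ V, T V = V := by
  have h : ContractingWith (Real.toNNReal γ) T := by
    refine ⟨by simpa using hγ₁, LipschitzWith.of_dist_le_mul fun U V => ?_⟩
    rw [Real.coe_toNNReal γ hγ₀, dist_pi_le_iff (mul_nonneg hγ₀ dist_nonneg)]
    exact hT U V (dist U V) (fun i => dist_le_pi_dist U V i) dist_nonneg
  exact ⟨h.fixedPoint T, h.fixedPoint_isFixedPt⟩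

-- Raising the exponents by at most η δ multiplies the sum by at most exp (η δ). If all weights on
-- `s` vanish, both logarithms are log 0 = 0.
omit [Fintype Z] in
lemma abs_log_sum_exp_sub_le (s : Finset Z) {w a b : Z → ℝ} (hw : ∀ z, 0 ≤ w z) {η δ : ℝ}
    (hη : 0 ≤ η) (hδ : 0 ≤ δ) (hab : ∀ z, |a z - b z| ≤ δ) :
    |Real.log (∑ z ∈ s, w z * Real.exp (-η * a z)) - Real.log (∑ z ∈ s, w z * Real.exp (-η * b z))|
      ≤ η * δ := by
  have key : ∀ a b : Z → ℝ, (∀ z, |a z - b z| ≤ δ) →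
      Real.log (∑ z ∈ s, w z * Real.exp (-η * a z)) - Real.log (∑ z ∈ s, w z * Real.exp (-η * b z))
        ≤ η * δ := by
    intro a b hab
    by_cases h : ∃ z ∈ s, 0 < w z
    · obtain ⟨z, hz, hz'⟩ := h
      have hpos : ∀ a : Z → ℝ, 0 < ∑ z ∈ s, w z * Real.exp (-η * a z) := fun a =>
        Finset.sum_pos' (fun _ _ => mul_nonneg (hw _) (Real.exp_nonneg _))
          ⟨z, hz, mul_pos hz' (Real.exp_pos _)⟩
      have hle : ∑ z ∈ s, w z * Real.exp (-η * a z)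
          ≤ Real.exp (η * δ) * ∑ z ∈ s, w z * Real.exp (-η * b z) := by
        rw [Finset.mul_sum]
        refine Finset.sum_le_sum fun z _ => ?_
        rw [mul_left_comm, ← Real.exp_add]
        refine mul_le_mul_of_nonneg_left (Real.exp_le_exp.2 ?_) (hw z)
        nlinarith [(abs_le.1 (hab z)).1]
      have h1 := Real.log_le_log (hpos a) hle
      rw [Real.log_mul (Real.exp_ne_zero _) (hpos b).ne', Real.log_exp] at h1
      linarith
    · push Not at h
      have h0 : ∀ a : Z → ℝ, ∑ z ∈ s, w z * Real.exp (-η * a z) = 0 := fun a =>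
        Finset.sum_eq_zero fun z hz => by rw [le_antisymm (h z hz) (hw z), zero_mul]
      rw [h0, h0, sub_self]
      exact mul_nonneg hη hδ
  rw [abs_le]
  constructor
  · have := key b a fun z => by rw [abs_sub_comm]; exact hab z
    linarith
  · exact key a b hab

lemma abs_sum_mul_sub_le {q u v : Z → ℝ} (hq : ∀ z, 0 ≤ q z) (hq₁ : ∑ z, q z = 1) {δ : ℝ}
    (h : ∀ z, |u z - v z| ≤ δ) : |∑ z, q z * u z - ∑ z, q z * v z| ≤ δ := by
  rw [← Finset.sum_sub_distrib]
  calc |∑ z, (q z * u z - q z * v z)| ≤ ∑ z, |q z * u z - q z * v z| :=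
        Finset.abs_sum_le_sum_abs _ _
    _ ≤ ∑ z, q z * δ := by
        refine Finset.sum_le_sum fun z _ => ?_
        rw [← mul_sub, abs_mul, abs_of_nonneg (hq z)]
        exact mul_le_mul_of_nonneg_left (h z) (hq z)
    _ = δ := by rw [← Finset.sum_mul, hq₁, one_mul]

lemma exists_bellmanSinkhorn_eq (hγ₀ : 0 ≤ γ) (hγ₁ : γ < 1) (hη : 0 ≤ η)
    (hπ : ∀ z z', 0 ≤ π z z') (hp : ∀ z l, 0 ≤ p z l) (hp₁ : ∀ z, ∑ l, p z l = 1) :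
    ∃ V, bellmanSinkhorn ℓ p c γ η π V = V := by
  -- For η = 0, which occurs in the degenerate cases of the theorem, 1 / η is 0 and the operator
  -- vanishes.
  rcases hη.eq_or_lt with rfl | hη'
  · refine ⟨0, ?_⟩
    ext z l
    simp [bellmanSinkhorn]
  obtain ⟨V, hV⟩ := exists_fixedPoint_of_contraction (ι := Z × L) hγ₀ hγ₁
    (fun V => Function.uncurry (bellmanSinkhorn ℓ p c γ η π (Function.curry V))) (by
      rintro U V δ h hδ ⟨z, l⟩
      have hQ : ∀ z', |labelQ p c γ (Function.curry U) z z' - labelQ p c γ (Function.curry V) z z'|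
          ≤ γ * δ := by
        intro z'
        rw [labelQ, labelQ, add_sub_add_left_eq_sub, ← mul_sub, abs_mul, abs_of_nonneg hγ₀]
        exact mul_le_mul_of_nonneg_left
          (abs_sum_mul_sub_le (hp z') (hp₁ z') fun l => h (z', l)) hγ₀
      have h1 := abs_log_sum_exp_sub_le (Finset.univ.filter fun z' => ℓ z' = l)
        (w := fun z' => π z z' / p z l) (fun z' => div_nonneg (hπ _ _) (hp _ _)) hη
        (mul_nonneg hγ₀ hδ) hQ
      simp only [Function.uncurry_apply_pair, bellmanSinkhorn]
      rw [← mul_sub, abs_mul, abs_neg, abs_of_pos (one_div_pos.2 hη')]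
      calc _ ≤ 1 / η * (η * (γ * δ)) := mul_le_mul_of_nonneg_left h1 (one_div_pos.2 hη').le
        _ = γ * δ := by field_simp)
  refine ⟨Function.curry V, ?_⟩
  ext z l
  exact congrFun hV (z, l)

/-- The solution of the Bellman evaluation equation of the transition matrix `G`. -/
lemma exists_bellman_eq (hγ₀ : 0 ≤ γ) (hγ₁ : γ < 1) {G : Z → Z → ℝ} (hG : ∀ z z', 0 ≤ G z z')
    (hG₁ : ∀ z, ∑ z', G z z' = 1) {C : ℝ} (hc₀ : ∀ z, 0 ≤ c z) (hc : ∀ z, c z ≤ C) :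
    ∃ U : Z → ℝ, (∀ z, U z = c z + γ * ∑ z', G z z' * U z') ∧
      ∀ z, 0 ≤ U z ∧ U z ≤ C / (1 - γ) := by
  obtain ⟨U, hU⟩ := exists_fixedPoint_of_contraction hγ₀ hγ₁
    (fun (U : Z → ℝ) z => c z + γ * ∑ z', G z z' * U z') (by
      intro U V δ h hδ z
      rw [add_sub_add_left_eq_sub, ← mul_sub, abs_mul, abs_of_nonneg hγ₀]
      exact mul_le_mul_of_nonneg_left (abs_sum_mul_sub_le (hG z) (hG₁ z) h) hγ₀)
  have hU' : ∀ z, U z = c z + γ * ∑ z', G z z' * U z' := fun z => (congrFun hU z).symm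
  refine ⟨U, hU', fun z => ?_⟩
  have : Nonempty Z := ⟨z⟩
  have h1γ : 0 < 1 - γ := by linarith
  constructor
  -- Maximum principle: at an extremal state the average of U under G is on the favourable side of U
  -- itself.
  · obtain ⟨m, hm⟩ := Finite.exists_min U
    have h1 : U m ≤ ∑ z', G m z' * U z' := by
      calc U m = ∑ z', G m z' * U m := by rw [← Finset.sum_mul, hG₁, one_mul]
        _ ≤ _ := Finset.sum_le_sum fun z' _ => mul_le_mul_of_nonneg_left (hm z') (hG _ _)
    have h2 := mul_le_mul_of_nonneg_left h1 hγ₀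
    have h3 : 0 ≤ (1 - γ) * U m := by linarith [hU' m, hc₀ m]
    exact (nonneg_of_mul_nonneg_right h3 h1γ).trans (hm z)
  · obtain ⟨m, hm⟩ := Finite.exists_max U
    have h1 : ∑ z', G m z' * U z' ≤ U m := by
      calc _ ≤ ∑ z', G m z' * U m :=
            Finset.sum_le_sum fun z' _ => mul_le_mul_of_nonneg_left (hm z') (hG _ _)
        _ = U m := by rw [← Finset.sum_mul, hG₁, one_mul]
    have h2 := mul_le_mul_of_nonneg_left h1 hγ₀
    rw [le_div_iff₀ h1γ]
    nlinarith [hU' m, hc m, hm z]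

/-- The performance difference between a flow with transitions `F` and the transition matrix
`G`. -/
lemma IsFlow.performance {z₀ : Z} {μ : Z → Z → ℝ} (h : IsFlow γ z₀ μ) (hγ₀ : 0 ≤ γ) (hγ₁ : γ ≤ 1)
    {F G : Z → Z → ℝ} (hF : ∀ z z', μ z z' = (∑ z'', μ z z'') * F z z') {U : Z → ℝ} {B : ℝ}
    (hU : ∀ z, U z = c z + γ * ∑ z', G z z' * U z') (hB : ∀ z, 0 ≤ U z ∧ U z ≤ B) :
    (1 - γ) * U z₀ ≤ flowCost c μ + B * ∑ z, (∑ z', μ z z') * ∑ z', |G z z' - F z z'| := by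
  rw [← h.dual U, flowCost, Finset.mul_sum, ← Finset.sum_add_distrib]
  refine Finset.sum_le_sum fun z _ => ?_
  set ν := ∑ z', μ z z' with hν
  have hν₀ : 0 ≤ ν := Finset.sum_nonneg fun _ _ => h.nonneg _ _
  have h1 : ∑ z', μ z z' * (U z - γ * U z') = ν * U z - γ * (ν * ∑ z', F z z' * U z') := by
    simp_rw [mul_sub]
    rw [Finset.sum_sub_distrib, ← Finset.sum_mul, Finset.mul_sum, Finset.mul_sum]
    congr 1
    refine Finset.sum_congr rfl fun z' _ => ?_
    rw [hF z z']
    ring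
  have h2 : γ * (∑ z', G z z' * U z' - ∑ z', F z z' * U z') ≤ B * ∑ z', |G z z' - F z z'| := by
    rw [← Finset.sum_sub_distrib, Finset.mul_sum, Finset.mul_sum]
    refine Finset.sum_le_sum fun z' _ => ?_
    rw [← sub_mul]
    have h3 := le_abs_self (G z z' - F z z')
    have h4 := abs_nonneg (G z z' - F z z')
    obtain ⟨h5, h6⟩ := hB z'
    calc γ * ((G z z' - F z z') * U z') ≤ γ * (|G z z' - F z z'| * U z') := by gcongr
      _ ≤ 1 * (|G z z' - F z z'| * U z') := by gcongr
      _ ≤ B * |G z z' - F z z'| := by nlinarith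
  have h3 := mul_le_mul_of_nonneg_left h2 hν₀
  rw [h1, ← Finset.sum_mul, ← hν, hU z]
  linarith

end Flow

/-! ### One round: regret, relative entropy and constraint violation -/

section Round

variable {Z L L' : Type*} [Fintype Z] [Fintype L] [DecidableEq L] [Fintype L'] [DecidableEq L']

/-- As π meets the constraint, p may be replaced by the label sums of π, and the triangle inequality
compares π' with π. -/
lemma labelError_le_of_label_eq {ℓ : Z → L} {p : Z → L → ℝ} {π π' μ : Z → Z → ℝ}
    (hπ : ∀ z l, ∑ z' with ℓ z' = l, π z z' = p z l) (hμ₀ : ∀ z z', 0 ≤ μ z z')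
    (hμ : ∀ z z', μ z z' = (∑ z'', μ z z'') * π' z z') :
    labelError ℓ p μ ≤ ∑ z, (∑ z', μ z z') * ∑ z', |π' z z' - π z z'| := by
  refine Finset.sum_le_sum fun z _ => ?_
  set ν := ∑ z', μ z z' with hν
  have hν₀ : 0 ≤ ν := Finset.sum_nonneg fun _ _ => hμ₀ _ _
  calc ∑ l, |∑ z' with ℓ z' = l, μ z z' - ν * p z l|
      ≤ ∑ l, ∑ z' with ℓ z' = l, ν * |π' z z' - π z z'| := by
        refine Finset.sum_le_sum fun l _ => ?_
        rw [← hπ z l, Finset.mul_sum, ← Finset.sum_sub_distrib]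
        refine (Finset.abs_sum_le_sum_abs _ _).trans (Finset.sum_le_sum fun z' _ => ?_)
        rw [hμ z z', ← hν, ← mul_sub, abs_mul, abs_of_nonneg hν₀]
    _ = ν * ∑ z', |π' z z' - π z z'| := by rw [sum_label, Finset.mul_sum]

/-- The relative entropy of consecutive transition matrices controls their distance. -/
lemma mul_dist_le_entropy {γ : ℝ} (hγ₁ : γ < 1) {z₀ : Z} {π π' μ : Z → Z → ℝ}
    (hπ : ∀ z z', 0 ≤ π z z') (hπ' : ∀ z z', 0 ≤ π' z z') (hs : ∀ z z', 0 < π' z z' → 0 < π z z')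
    (hπ₁ : ∀ z, ∑ z', π z z' = 1) (hπ'₁ : ∀ z, ∑ z', π' z z' = 1) (hμ₀ : IsFlow γ z₀ μ)
    (hμ : ∀ z z', μ z z' = (∑ z'', μ z z'') * π' z z') (b : ℝ) :
    b * ∑ z, (∑ z', μ z z') * ∑ z', |π' z z' - π z z'|
      ≤ ∑ z, ∑ z', μ z z' * (Real.log (π' z z') - Real.log (π z z')) + b ^ 2 := by
  have h1 : b ^ 2 = ∑ z, (∑ z', μ z z') * b ^ 2 := by
    rw [← Finset.sum_mul, hμ₀.sum_eq_one hγ₁, one_mul]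
  rw [h1, Finset.mul_sum, ← Finset.sum_add_distrib]
  refine Finset.sum_le_sum fun z _ => ?_
  have h2 := mul_le_mul_of_nonneg_left
    (mul_sum_abs_sub_le (hπ' z) (hπ z) (hs z) (hπ'₁ z) (hπ₁ z) b)
    (Finset.sum_nonneg fun z' (_ : z' ∈ Finset.univ) => hμ₀.nonneg z z')
  calc _ = (∑ z', μ z z') * (b * ∑ z', |π' z z' - π z z'|) := by ring
    _ ≤ _ := h2
    _ = _ := by
      rw [mul_add, Finset.mul_sum]
      congr 1
      refine Finset.sum_congr rfl fun z' _ => ?_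
      rw [hμ z z']
      ring

/-- One round of Sinkhorn Value Iteration: regret and constraint violation. -/
lemma round_bound {ℓ : Z → L} {p : Z → L → ℝ} {ℓ' : Z → L'} {p' : Z → L' → ℝ} {c : Z → ℝ}
    {γ η b : ℝ} (hγ₁ : γ < 1) (hη : η ≠ 0) (hb : 0 ≤ b) {z₀ : Z} {π π' μs μ : Z → Z → ℝ}
    {V : Z → L → ℝ}
    (hπ : ∀ z z', 0 ≤ π z z') (hπ' : ∀ z z', 0 ≤ π' z z')
    (hπ₁ : ∀ z, ∑ z', π z z' = 1) (hπ'₁ : ∀ z, ∑ z', π' z z' = 1)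
    (hp'₀ : ∀ z l, 0 ≤ p' z l) (hp' : ∀ z, ∑ l, p' z l = 1)
    (hV : bellmanSinkhorn ℓ p c γ η π V = V) (hu : ∀ z z', π' z z' = labelUpdate ℓ p c γ η π V z z')
    (hl : ∀ z l, ∑ z' with ℓ z' = l, π' z z' = p z l)
    (hμs : IsFlow γ z₀ μs) (hμsl : HasLabelLaw ℓ p μs) (hs : ∀ z z', 0 < μs z z' → 0 < π z z')
    (hμ : IsFlow γ z₀ μ) (hμπ : ∀ z z', μ z z' = (∑ z'', μ z z'') * π' z z') {e : ℝ}
    (he : (2 * b ≤ e) ∨ (0 ≤ e ∧ ∀ z l, ∑ z' with ℓ' z' = l, π z z' = p' z l)) :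
    η * (flowCost c μ - flowCost c μs) + b * (labelError ℓ p μ + labelError ℓ' p' μ)
      ≤ ∑ z, ∑ z', μs z z' * (Real.log (π' z z') - Real.log (π z z')) + b ^ 2 + e := by
  have hμl : HasLabelLaw ℓ p μ := fun z l => by
    rw [Finset.sum_congr rfl fun z' _ => hμπ z z', ← Finset.mul_sum, hl]
  have hs' : ∀ z z', 0 < π' z z' → 0 < π z z' := fun z z' h =>
    pos_of_labelUpdate_pos hπ ((hu z z').symm.trans_ne h.ne')
  have hsμ : ∀ z z', 0 < μ z z' → 0 < π z z' := fun z z' h => by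
    rw [hμπ] at h
    exact hs' z z' (pos_of_mul_pos_right h (Finset.sum_nonneg fun _ _ => hμ.nonneg _ _))
  -- Both identities contain the same value at z₀; their difference is the regret against μs.
  have h1 := hμs.sum_log_labelUpdate hμsl hη hπ hV hs
  have h2 := hμ.sum_log_labelUpdate hμl hη hπ hV hsμ
  simp only [← hu] at h1 h2
  have h3 := mul_dist_le_entropy hγ₁ hπ hπ' hs' hπ₁ hπ'₁ hμ hμπ
  have h4 : b * labelError ℓ' p' μ
      ≤ ∑ z, ∑ z', μ z z' * (Real.log (π' z z') - Real.log (π z z')) + b ^ 2 + e := by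
    rcases he with he | ⟨he, hπl⟩
    -- Parameter 0 in Pinsker's inequality: the relative entropy is nonnegative.
    · have h5 := h3 0
      have h6 := mul_le_mul_of_nonneg_left (labelError_le_two hμ hγ₁ ℓ' hp'₀ hp') hb
      nlinarith [sq_nonneg b]
    · have h5 := mul_le_mul_of_nonneg_left (labelError_le_of_label_eq hπl hμ.nonneg hμπ) hb
      linarith [h3 b]
  rw [labelError_eq_zero hμl, zero_add]
  linarith

end Round

/-! ### The rounding procedure -/

section Rounding

variable {X Y : Type*} [Fintype X] [Fintype Y]

lemma min_div_mul {p r : ℝ} (hp : 0 ≤ p) (hr : 0 ≤ r) : min (p / r) 1 * r = min p r := by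
  rcases hr.eq_or_lt with rfl | hr'
  · simp [hp]
  · rw [min_mul_of_nonneg _ _ hr, div_mul_cancel₀ _ hr'.ne', one_mul]

/-- The positive part of r - p. Summed over vectors of equal mass, the linear terms cancel and half
the ℓ¹ distance remains. -/
lemma sub_min_eq (p r : ℝ) : r - min p r = (|r - p| + (r - p)) / 2 := by
  rcases le_total p r with h | h
  · rw [min_eq_left h, abs_of_nonneg (by linarith)]; ring
  · rw [min_eq_right h, abs_of_nonpos (by linarith)]; ring

omit [Fintype X] in
lemma sum_roundRows {F : X × Y → ℝ} (hF : ∀ z, 0 ≤ F z) {p : X → ℝ} (hp : ∀ x, 0 ≤ p x) (x : X) :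
    ∑ y, roundRows F p (x, y) = min (p x) (∑ y, F (x, y)) := by
  simp only [roundRows]
  rw [← Finset.mul_sum, min_div_mul (hp x) (Finset.sum_nonneg fun _ _ => hF _)]

omit [Fintype Y] in
lemma sum_roundCols {F : X × Y → ℝ} (hF : ∀ z, 0 ≤ F z) {q : Y → ℝ} (hq : ∀ y, 0 ≤ q y) (y : Y) :
    ∑ x, roundCols F q (x, y) = min (q y) (∑ x, F (x, y)) := by
  simp only [roundCols]
  rw [← Finset.sum_mul, mul_comm, min_div_mul (hq y) (Finset.sum_nonneg fun _ _ => hF _)]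

omit [Fintype X] in
lemma roundRows_mem {F : X × Y → ℝ} (hF : ∀ z, 0 ≤ F z) {p : X → ℝ} (hp : ∀ x, 0 ≤ p x)
    (z : X × Y) : 0 ≤ roundRows F p z ∧ roundRows F p z ≤ F z :=
  ⟨mul_nonneg (le_min (div_nonneg (hp _) (Finset.sum_nonneg fun _ _ => hF _)) zero_le_one) (hF z),
    mul_le_of_le_one_left (hF z) (min_le_right _ _)⟩

omit [Fintype Y] in
lemma roundCols_mem {F : X × Y → ℝ} (hF : ∀ z, 0 ≤ F z) {q : Y → ℝ} (hq : ∀ y, 0 ≤ q y)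
    (z : X × Y) : 0 ≤ roundCols F q z ∧ roundCols F q z ≤ F z :=
  ⟨mul_nonneg (hF z) (le_min (div_nonneg (hq _) (Finset.sum_nonneg fun _ _ => hF _)) zero_le_one),
    mul_le_of_le_one_right (hF z) (min_le_right _ _)⟩

/-- The rounding of a probability matrix is a probability matrix, and it moves at most as much mass
as the marginals are off. -/
lemma roundCoupling_spec {F : X × Y → ℝ} (hF : ∀ z, 0 ≤ F z) (hF₁ : ∑ z, F z = 1) {p : X → ℝ}
    (hp : ∀ x, 0 ≤ p x) (hp₁ : ∑ x, p x = 1) {q : Y → ℝ} (hq : ∀ y, 0 ≤ q y) (hq₁ : ∑ y, q y = 1) :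
    (∀ z, 0 ≤ roundCoupling F p q z) ∧ ∑ z, roundCoupling F p q z = 1 ∧
      ∑ z, |roundCoupling F p q z - F z|
        ≤ ∑ x, |∑ y, F (x, y) - p x| + ∑ y, |∑ x, F (x, y) - q y| := by
  set F₁ := roundRows F p with hF₁def
  set F₂ := roundCols F₁ q with hF₂def
  have m₁ := roundRows_mem hF hp
  have m₂ := roundCols_mem (fun z => (m₁ z).1) hq
  set ep : X → ℝ := fun x => p x - ∑ y, F₂ (x, y) with hep
  set eq : Y → ℝ := fun y => q y - ∑ x, F₂ (x, y) with heq
  have hep₀ : ∀ x, 0 ≤ ep x := by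
    intro x
    have h1 : ∑ y, F₂ (x, y) ≤ ∑ y, F₁ (x, y) := Finset.sum_le_sum fun y _ => (m₂ (x, y)).2
    have h2 := sum_roundRows hF hp x
    have h3 := min_le_left (p x) (∑ y, F (x, y))
    simp only [hep]
    linarith
  have heq₀ : ∀ y, 0 ≤ eq y := by
    intro y
    have h2 := sum_roundCols (fun z => (m₁ z).1) hq y
    have h3 := min_le_left (q y) (∑ x, F₁ (x, y))
    simp only [heq]
    linarith
  set Δ := ∑ x, ep x with hΔ
  have hΔ₀ : 0 ≤ Δ := Finset.sum_nonneg fun x _ => hep₀ x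
  have hΔp : Δ = 1 - ∑ z, F₂ z := by
    rw [hΔ, Finset.sum_sub_distrib, hp₁, Fintype.sum_prod_type]
  have hΔq : ∑ y, eq y = Δ := by
    rw [hΔp, Finset.sum_sub_distrib, hq₁, Fintype.sum_prod_type_right]
  have hG : ∀ z, roundCoupling F p q z = F₂ z + ep z.1 * eq z.2 / Δ := by
    intro z
    have : ∑ x, |ep x| = Δ := Finset.sum_congr rfl fun x _ => abs_of_nonneg (hep₀ x)
    rw [← this]
    rfl
  have hcorr₀ : ∀ z : X × Y, 0 ≤ ep z.1 * eq z.2 / Δ := fun z =>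
    div_nonneg (mul_nonneg (hep₀ _) (heq₀ _)) hΔ₀
  have hcorr : ∑ z : X × Y, ep z.1 * eq z.2 / Δ = Δ := by
    rw [← Finset.sum_div, Fintype.sum_prod_type]
    simp only
    rw [← Finset.sum_mul_sum, ← hΔ, hΔq]
    -- This includes Δ = 0, where the correction is zero by division by zero.
    exact mul_self_div_self Δ
  refine ⟨fun z => ?_, ?_, ?_⟩
  · rw [hG]
    exact add_nonneg (m₂ z).1 (hcorr₀ z)
  · simp_rw [hG]
    rw [Finset.sum_add_distrib, hcorr, hΔp]
    ring
  -- The scalings remove mass Δ and the correction restores it. Each scaling removes at most half of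
  -- the corresponding marginal error of F.
  · have h1 : ∑ z, |roundCoupling F p q z - F z| ≤ 2 * Δ := by
      calc ∑ z, |roundCoupling F p q z - F z|
          ≤ ∑ z, ((F z - F₂ z) + ep z.1 * eq z.2 / Δ) := by
            refine Finset.sum_le_sum fun z _ => ?_
            rw [hG, abs_le]
            have h2 := hcorr₀ z
            have h3 := (m₂ z).2.trans (m₁ z).2
            constructor <;> linarith
        _ = 2 * Δ := by
            rw [Finset.sum_add_distrib, hcorr, Finset.sum_sub_distrib, hF₁, ← hΔp]
            ring
    have h2 : ∑ z, F z - ∑ z, F₁ z = (∑ x, |∑ y, F (x, y) - p x|) / 2 := by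
      rw [Fintype.sum_prod_type, Fintype.sum_prod_type, ← Finset.sum_sub_distrib]
      calc ∑ x, (∑ y, F (x, y) - ∑ y, F₁ (x, y))
          = ∑ x, (|∑ y, F (x, y) - p x| + (∑ y, F (x, y) - p x)) / 2 :=
            Finset.sum_congr rfl fun x _ => by rw [hF₁def, sum_roundRows hF hp, sub_min_eq]
        _ = _ := by
            rw [← Finset.sum_div, Finset.sum_add_distrib, Finset.sum_sub_distrib, hp₁,
              ← Fintype.sum_prod_type, hF₁]
            ring
    have h3 : ∑ z, F₁ z - ∑ z, F₂ z ≤ (∑ y, |∑ x, F (x, y) - q y|) / 2 := by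
      rw [Fintype.sum_prod_type_right, Fintype.sum_prod_type_right, ← Finset.sum_sub_distrib]
      calc ∑ y, (∑ x, F₁ (x, y) - ∑ x, F₂ (x, y))
          ≤ ∑ y, (|∑ x, F (x, y) - q y| + (∑ x, F (x, y) - q y)) / 2 := by
            refine Finset.sum_le_sum fun y _ => ?_
            rw [hF₂def, sum_roundCols (fun z => (m₁ z).1) hq, ← sub_min_eq]
            -- The row scaling only lowers the column sums, so the excess over q does not grow.
            have h4 : ∑ x, F₁ (x, y) ≤ ∑ x, F (x, y) :=
              Finset.sum_le_sum fun x _ => (m₁ (x, y)).2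
            rcases le_total (q y) (∑ x, F₁ (x, y)) with h | h
            · rw [min_eq_left h, min_eq_left (h.trans h4)]; linarith
            · rw [min_eq_right h, sub_self]
              exact sub_nonneg.2 (min_le_right _ _)
        _ = _ := by
            rw [← Finset.sum_div, Finset.sum_add_distrib, Finset.sum_sub_distrib, hq₁,
              ← Fintype.sum_prod_type_right, hF₁]
            ring
    linarith

end Rounding

/-! ### Transition probabilities as real matrices -/

section Prob

variable {S : Type*}

lemma prob_nonneg (P : S → PMF S) (s s' : S) : 0 ≤ prob P s s' := ENNReal.toReal_nonneg

lemma sum_prob [Fintype S] (P : S → PMF S) (s : S) : ∑ s', prob P s s' = 1 := by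
  have h := (P s).tsum_coe
  rw [tsum_fintype] at h
  unfold prob
  rw [← ENNReal.toReal_sum fun s' _ => (P s).apply_ne_top s', h, ENNReal.toReal_one]

lemma prob_le_one (P : S → PMF S) (s s' : S) : prob P s s' ≤ 1 :=
  ENNReal.toReal_le_of_le_ofReal zero_le_one (by simpa using (P s).coe_le_one s')

lemma exists_prob_eq [Fintype S] {f : S → S → ℝ} (hf : ∀ s s', 0 ≤ f s s')
    (hf₁ : ∀ s, ∑ s', f s s' = 1) : ∃ P : S → PMF S, ∀ s s', prob P s s' = f s s' := by
  refine ⟨fun s => PMF.ofFintype (fun s' => ENNReal.ofReal (f s s')) ?_, fun s s' => ?_⟩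
  · rw [← ENNReal.ofReal_sum_of_nonneg fun s' _ => hf s s', hf₁, ENNReal.ofReal_one]
  · rw [prob, PMF.ofFintype_apply, ENNReal.toReal_ofReal (hf s s')]

end Prob

/-! ### Occupancies as flows, and the Bellman equation -/

section Chains

variable {S L : Type*} [Fintype S] [MeasurableSpace S] [MeasurableSingletonClass S]

lemma measureReal_zero_eq (M : Measure (ℕ → S)) [IsProbabilityMeasure M] {s₀ : S}
    (h : ∀ᵐ ω ∂M, ω 0 = s₀) [DecidableEq S] (s : S) :
    M.real {ω | ω 0 = s} = if s = s₀ then 1 else 0 := by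
  have hm : MeasurableSet {ω : ℕ → S | ω 0 = s} := measurableSet_coord 0 {s}
  split_ifs with hs
  · have h1 : M {ω | ω 0 = s}ᶜ = 0 := by
      rw [measure_eq_zero_iff_ae_notMem]
      filter_upwards [h] with ω h hω
      exact hω (h.trans hs.symm)
    rw [measureReal_def, (prob_compl_eq_zero_iff hm).1 h1, ENNReal.toReal_one]
  · have h1 : M {ω | ω 0 = s} = 0 := by
      rw [measure_eq_zero_iff_ae_notMem]
      filter_upwards [h] with ω h hω
      exact hs (hω.symm.trans h)
    rw [measureReal_def, h1, ENNReal.toReal_zero]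

lemma isFlow_discountedPair {γ : ℝ} (hγ₀ : 0 ≤ γ) (hγ₁ : γ < 1) (M : Measure (ℕ → S))
    [IsProbabilityMeasure M] {s₀ : S} (h : ∀ᵐ ω ∂M, ω 0 = s₀) :
    IsFlow γ s₀ (discountedPair γ M) := by
  classical
  refine ⟨discountedPair_nonneg hγ₀ hγ₁ M, fun g => ?_⟩
  have h1 := Finset.sum_congr rfl fun s (_ : s ∈ (Finset.univ : Finset S)) =>
    congrArg (fun a => a * g s) (discountedState_flow hγ₀ hγ₁ M s)
  simp only [measureReal_zero_eq M h, add_mul, Finset.sum_add_distrib, mul_ite, ite_mul, mul_one,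
    mul_zero, zero_mul, Finset.sum_ite_eq', Finset.mem_univ, if_true] at h1
  simp only [mul_sub, Finset.sum_sub_distrib]
  rw [sub_eq_iff_eq_add, add_comm]
  simp only [← Finset.sum_mul]
  rw [h1, Finset.sum_comm]
  congr 1
  refine Finset.sum_congr rfl fun s _ => ?_
  rw [← Finset.sum_mul]
  ring

lemma isFlow_chainLaw {γ : ℝ} (hγ₀ : 0 ≤ γ) (hγ₁ : γ < 1) (P : S → PMF S) (s₀ : S) :
    IsFlow γ s₀ (discountedPair γ (chainLaw P s₀)) :=
  isFlow_discountedPair hγ₀ hγ₁ _ (chainLaw_zero P s₀)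

lemma discountedPair_chainLaw {γ : ℝ} (hγ₀ : 0 ≤ γ) (hγ₁ : γ < 1) (P : S → PMF S) (s₀ s s' : S) :
    discountedPair γ (chainLaw P s₀) s s'
      = (∑ s'', discountedPair γ (chainLaw P s₀) s s'') * prob P s s' := by
  classical
  rw [← (isMarkovAlong_chainLaw P s₀).sum_discountedPair hγ₀ hγ₁ s s']
  simp [Finset.sum_filter]

lemma value_eq {γ : ℝ} (hγ₀ : 0 ≤ γ) (hγ₁ : γ < 1) (c : S → ℝ) (P : S → PMF S) (s₀ : S) :
    (1 - γ) * value c γ P s₀ = flowCost c (discountedPair γ (chainLaw P s₀)) :=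
  integral_discountedCost hγ₀ hγ₁ _ c

/-- The value function solves the Bellman equation. -/
lemma value_eq_of_bellman {γ : ℝ} (hγ₀ : 0 ≤ γ) (hγ₁ : γ < 1) (c : S → ℝ) (P : S → PMF S) (s₀ : S)
    {U : S → ℝ} (hU : ∀ s, U s = c s + γ * ∑ s', prob P s s' * U s') :
    value c γ P s₀ = U s₀ := by
  have h1γ : 0 < 1 - γ := by linarith
  refine mul_left_cancel₀ h1γ.ne' ?_
  rw [value_eq hγ₀ hγ₁, ← (isFlow_chainLaw hγ₀ hγ₁ P s₀).dual U, flowCost]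
  refine Finset.sum_congr rfl fun s _ => ?_
  have h1 : ∑ s', discountedPair γ (chainLaw P s₀) s s' * U s'
      = (∑ s', discountedPair γ (chainLaw P s₀) s s') * ∑ s', prob P s s' * U s' := by
    rw [Finset.mul_sum]
    refine Finset.sum_congr rfl fun s' _ => ?_
    rw [discountedPair_chainLaw hγ₀ hγ₁ P s₀ s s', mul_assoc]
  simp only [mul_sub, Finset.sum_sub_distrib, ← Finset.sum_mul, mul_left_comm _ γ, ← Finset.mul_sum]
  rw [h1]
  linear_combination (-∑ s', discountedPair γ (chainLaw P s₀) s s') * hU s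

omit [Fintype S] [MeasurableSingletonClass S] in
lemma condProb_eq (M : Measure (ℕ → S)) (n : ℕ) (w : ℕ → S) (s : S) :
    condProb M n w s = M.real (past n w ∩ {ω | ω (n + 1) = s}) / M.real (past n w) := rfl

lemma condProb_chainLaw (P : S → PMF S) (s₀ : S) (n : ℕ) (w : ℕ → S)
    (hw : (chainLaw P s₀).real (past n w) ≠ 0) (s : S) :
    condProb (chainLaw P s₀) n w s = prob P (w n) s := by
  rw [condProb_eq]
  have := isMarkovAlong_chainLaw P s₀ n w s
  simp only [id] at this
  rw [this, mul_div_cancel_left₀ _ hw]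

end Chains

/-! ### Bicausal couplings and the Markov property along each coordinate -/

section Bicausal

variable {X Y : Type*} [Fintype X] [Fintype Y]

lemma sum_filter_fst [DecidableEq X] (f : X × Y → ℝ) (x : X) :
    ∑ z with z.1 = x, f z = ∑ y, f (x, y) := by
  rw [Finset.sum_filter, Fintype.sum_prod_type]
  simp only
  rw [Finset.sum_eq_single x]
  · simp
  · intro b _ hb
    simp [hb]
  · simp

lemma sum_filter_snd [DecidableEq Y] (f : X × Y → ℝ) (y : Y) :
    ∑ z with z.2 = y, f z = ∑ x, f (x, y) := by
  rw [Finset.sum_filter, Fintype.sum_prod_type_right]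
  simp only
  rw [Finset.sum_eq_single y]
  · simp
  · intro b _ hb
    simp [hb]
  · simp

variable [MeasurableSpace X] [MeasurableSpace Y]
  [MeasurableSingletonClass X] [MeasurableSingletonClass Y]

omit [Fintype X] [Fintype Y] [MeasurableSingletonClass X] [MeasurableSingletonClass Y] in
lemma measurable_fst_path : Measurable fun (ω : ℕ → X × Y) t => (ω t).1 :=
  measurable_pi_lambda _ fun t => measurable_fst.comp (measurable_pi_apply t)

omit [Fintype X] [Fintype Y] [MeasurableSingletonClass X] [MeasurableSingletonClass Y] in
lemma measurable_snd_path : Measurable fun (ω : ℕ → X × Y) t => (ω t).2 :=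
  measurable_pi_lambda _ fun t => measurable_snd.comp (measurable_pi_apply t)

lemma isProbabilityMeasure_of_map {A B : Type*} [MeasurableSpace A] [MeasurableSpace B]
    {M : Measure A} {N : Measure B} [IsProbabilityMeasure N] {f : A → B} (hf : Measurable f)
    (h : M.map f = N) : IsProbabilityMeasure M := by
  constructor
  rw [← Set.preimage_univ (f := f), ← Measure.map_apply hf MeasurableSet.univ, h, measure_univ]

/-- If a coordinate process of `M` is a Markov chain and the next state of the coordinate process
has the correct conditional law given the joint past, then `M` is Markovian along the coordinate. -/
lemma isMarkovAlong_of_condProb {Z S : Type*} [Fintype Z] [MeasurableSpace Z]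
    [MeasurableSingletonClass Z] [Fintype S] [MeasurableSpace S] [MeasurableSingletonClass S]
    [DecidableEq S] {M : Measure (ℕ → Z)} [IsProbabilityMeasure M] {ℓ : Z → S} {P : S → PMF S}
    {s₀ : S} (hmap : M.map (fun ω t => ℓ (ω t)) = chainLaw P s₀)
    (h : ∀ n w, M (past n w) ≠ 0 → ∀ s, ∑ z with ℓ z = s, condProb M n w z
      = condProb (chainLaw P s₀) n (fun i => ℓ (w i)) s) :
    IsMarkovAlong M ℓ fun z s => prob P (ℓ z) s := by
  intro n w s
  by_cases hw : M (past n w) = 0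
  · have h1 : M (past n w ∩ {ω | ℓ (ω (n + 1)) = s}) = 0 :=
      measure_mono_null Set.inter_subset_left hw
    rw [measureReal_def, measureReal_def, hw, h1]
    simp
  · have hmeas : Measurable fun (ω : ℕ → Z) t => ℓ (ω t) :=
      measurable_pi_lambda _ fun t => (measurable_of_finite ℓ).comp (measurable_pi_apply t)
    -- A joint past of positive probability has a label past of positive probability, so the
    -- conditional law of the chain is P and not a quotient 0 / 0.
    have hle : M (past n w) ≤ chainLaw P s₀ (past n fun i => ℓ (w i)) := by
      rw [← hmap, Measure.map_apply hmeas (measurableSet_past _ _)]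
      exact measure_mono fun ω hω i hi => congrArg ℓ (hω i hi)
    have hne : (chainLaw P s₀).real (past n fun i => ℓ (w i)) ≠ 0 := by
      rw [measureReal_def, ENNReal.toReal_ne_zero]
      exact ⟨fun h0 => hw (le_antisymm (hle.trans h0.le) zero_le), measure_ne_top _ _⟩
    have hne' : M.real (past n w) ≠ 0 := by
      rw [measureReal_def, ENNReal.toReal_ne_zero]
      exact ⟨hw, measure_ne_top _ _⟩
    have h1 := h n w hw s
    rw [condProb_chainLaw P s₀ n _ hne] at h1
    simp only [condProb_eq] at h1
    rw [← Finset.sum_div, ← measureReal_inter_label, div_eq_iff hne'] at h1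
    rw [h1, mul_comm]

/-- Conversely, a process that is Markovian along a label, with probabilities that depend on the
label only, induces a Markov chain of labels. -/
lemma map_eq_chainLaw {Z S : Type*} [Fintype Z] [MeasurableSpace Z]
    [MeasurableSingletonClass Z] [Fintype S] [MeasurableSpace S] [MeasurableSingletonClass S]
    {M : Measure (ℕ → Z)} [IsProbabilityMeasure M] {ℓ : Z → S} {P : S → PMF S}
    {s₀ : S} (h₀ : ∀ᵐ ω ∂M, ℓ (ω 0) = s₀)
    (h : IsMarkovAlong M ℓ fun z s => prob P (ℓ z) s) :
    M.map (fun ω t => ℓ (ω t)) = chainLaw P s₀ := by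
  have hmeas : Measurable fun (ω : ℕ → Z) t => ℓ (ω t) :=
    measurable_pi_lambda _ fun t => (measurable_of_finite ℓ).comp (measurable_pi_apply t)
  have : IsProbabilityMeasure (M.map fun ω t => ℓ (ω t)) :=
    Measure.isProbabilityMeasure_map hmeas.aemeasurable
  refine eq_of_isMarkovAlong ?_ (isMarkovAlong_chainLaw P s₀) ?_ (chainLaw_zero P s₀)
  · intro n w s
    have hm : MeasurableSet {ω : ℕ → S | id (ω (n + 1)) = s} := measurableSet_coord (n + 1) {s}
    rw [map_measureReal_apply hmeas ((measurableSet_past n w).inter hm),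
      map_measureReal_apply hmeas (measurableSet_past n w)]
    -- The past of the labels is coarser than that of the states, but the transition law is constant
    -- on it.
    refine h.measureReal_inter n _ ?_ s _ ?_
    · intro ω ω' hω hm i hi
      exact (congrArg ℓ (hω i hi)).symm.trans (hm i hi)
    · intro ω hω
      rw [show ℓ (ω n) = w n from hω n le_rfl]
  · have hm : MeasurableSet {ω : ℕ → S | ω 0 = s₀} := measurableSet_coord 0 {s₀}
    exact (ae_map_iff hmeas.aemeasurable hm).2 h₀

variable {PX : X → PMF X} {PY : Y → PMF Y} {x₀ : X} {y₀ : Y}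

lemma IsBicausal.isProbabilityMeasure {M : Measure (ℕ → X × Y)} (h : IsBicausal PX PY x₀ y₀ M) :
    IsProbabilityMeasure M :=
  isProbabilityMeasure_of_map measurable_fst_path h.1.1

lemma IsBicausal.isMarkovAlong_fst {M : Measure (ℕ → X × Y)} (h : IsBicausal PX PY x₀ y₀ M) :
    IsMarkovAlong M Prod.fst fun z x => prob PX z.1 x := by
  classical
  have := h.isProbabilityMeasure
  refine isMarkovAlong_of_condProb h.1.1 fun n w hw x => ?_
  exact (sum_filter_fst _ x).trans ((h.2 n w hw).1 x)

lemma IsBicausal.isMarkovAlong_snd {M : Measure (ℕ → X × Y)} (h : IsBicausal PX PY x₀ y₀ M) :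
    IsMarkovAlong M Prod.snd fun z y => prob PY z.2 y := by
  classical
  have := h.isProbabilityMeasure
  refine isMarkovAlong_of_condProb h.1.2 fun n w hw y => ?_
  exact (sum_filter_snd _ y).trans ((h.2 n w hw).2 y)

lemma IsBicausal.zero {M : Measure (ℕ → X × Y)} (h : IsBicausal PX PY x₀ y₀ M) :
    ∀ᵐ ω ∂M, ω 0 = (x₀, y₀) := by
  have h1 : ∀ᵐ ω ∂M, (ω 0).1 = x₀ := by
    have := chainLaw_zero PX x₀
    rw [← h.1.1] at this
    exact ae_of_ae_map measurable_fst_path.aemeasurable this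
  have h2 : ∀ᵐ ω ∂M, (ω 0).2 = y₀ := by
    have := chainLaw_zero PY y₀
    rw [← h.1.2] at this
    exact ae_of_ae_map measurable_snd_path.aemeasurable this
  filter_upwards [h1, h2] with ω h1 h2
  exact Prod.ext h1 h2

/-- The transition couplings yield bicausal couplings. -/
lemma isBicausal_chainLaw {π : X × Y → PMF (X × Y)}
    (hX : ∀ z x', ∑ y', prob π z (x', y') = prob PX z.1 x')
    (hY : ∀ z y', ∑ x', prob π z (x', y') = prob PY z.2 y') :
    IsBicausal PX PY x₀ y₀ (chainLaw π (x₀, y₀)) := by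
  classical
  have hM := isMarkovAlong_chainLaw π (x₀, y₀)
  have h1 : IsMarkovAlong (chainLaw π (x₀, y₀)) Prod.fst fun z x => prob PX z.1 x := by
    refine fun n w x => (hM.label Prod.fst n w x).trans ?_
    exact congrArg _ ((sum_filter_fst _ x).trans (hX _ x))
  have h2 : IsMarkovAlong (chainLaw π (x₀, y₀)) Prod.snd fun z y => prob PY z.2 y := by
    refine fun n w y => (hM.label Prod.snd n w y).trans ?_
    exact congrArg _ ((sum_filter_snd _ y).trans (hY _ y))
  have h0 := chainLaw_zero π (x₀, y₀)
  have c1 := map_eq_chainLaw (h0.mono fun ω h => congrArg Prod.fst h) h1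
  have c2 := map_eq_chainLaw (h0.mono fun ω h => congrArg Prod.snd h) h2
  refine ⟨⟨c1, c2⟩, fun n w hw => ?_⟩
  have hw' : (chainLaw π (x₀, y₀)).real (past n w) ≠ 0 := by
    rw [measureReal_def, ENNReal.toReal_ne_zero]
    exact ⟨hw, measure_ne_top _ _⟩
  constructor
  · intro x'
    rw [condProb_chainLaw]
    · simp only [condProb_chainLaw π (x₀, y₀) n w hw', hX]
    · rw [← c1, map_measureReal_apply measurable_fst_path (measurableSet_past _ _)]
      exact fun h => hw' (le_antisymm (h ▸ measureReal_mono fun ω hω i hi =>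
        congrArg Prod.fst (hω i hi)) measureReal_nonneg)
  · intro y'
    rw [condProb_chainLaw]
    · simp only [condProb_chainLaw π (x₀, y₀) n w hw', hY]
    · rw [← c2, map_measureReal_apply measurable_snd_path (measurableSet_past _ _)]
      exact fun h => hw' (le_antisymm (h ▸ measureReal_mono fun ω hω i hi =>
        congrArg Prod.snd (hω i hi)) measureReal_nonneg)

/-- The independent coupling is a witness. It is needed because the real infimum of the empty set is
0. -/
lemma exists_isBicausal (PX : X → PMF X) (PY : Y → PMF Y) (x₀ : X) (y₀ : Y) :
    ∃ M, IsBicausal PX PY x₀ y₀ M := by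
  obtain ⟨π, hπ⟩ := exists_prob_eq (f := fun z z' : X × Y => prob PX z.1 z'.1 * prob PY z.2 z'.2)
    (fun _ _ => mul_nonneg (prob_nonneg _ _ _) (prob_nonneg _ _ _)) (fun z => by
      rw [Fintype.sum_prod_type]
      simp only [← Finset.mul_sum, sum_prob, mul_one])
  refine ⟨_, isBicausal_chainLaw (π := π) ?_ ?_⟩
  · intro z x'
    simp only [hπ, ← Finset.mul_sum, sum_prob, mul_one]
  · intro z y'
    simp only [hπ, ← Finset.sum_mul, sum_prob, one_mul]

end Bicausal

/-! ### Averages of flows -/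

section Average

variable {Z L ι : Type*} [Fintype Z] [Fintype L] [DecidableEq L] {s : Finset ι} {a : ℝ}
  {μ : ι → Z → Z → ℝ}

lemma sum_comm_three {A B ι : Type*} [Fintype A] [Fintype B] (s : Finset ι) (f : ι → A → B → ℝ) :
    ∑ k ∈ s, ∑ a, ∑ b, f k a b = ∑ a, ∑ b, ∑ k ∈ s, f k a b := by
  rw [Finset.sum_comm]
  exact Finset.sum_congr rfl fun _ _ => Finset.sum_comm

omit [Fintype L] [DecidableEq L] in
lemma isFlow_average {γ : ℝ} {z₀ : Z} (ha : 0 ≤ a) (hs : a * s.card = 1)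
    (h : ∀ k ∈ s, IsFlow γ z₀ (μ k)) : IsFlow γ z₀ fun z z' => a * ∑ k ∈ s, μ k z z' := by
  refine ⟨fun z z' => mul_nonneg ha (Finset.sum_nonneg fun k hk => (h k hk).nonneg z z'),
    fun g => ?_⟩
  have h1 : ∀ z z', a * (∑ k ∈ s, μ k z z') * (g z - γ * g z')
      = a * ∑ k ∈ s, μ k z z' * (g z - γ * g z') := by
    intro z z'
    rw [mul_assoc, Finset.sum_mul]
  simp only [h1, ← Finset.mul_sum]
  rw [← sum_comm_three, Finset.sum_congr rfl fun k hk => (h k hk).dual g, Finset.sum_const, nsmul_eq_mul,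
    ← mul_assoc, hs, one_mul]

omit [Fintype L] [DecidableEq L] in
lemma flowCost_average (c : Z → ℝ) :
    flowCost c (fun z z' => a * ∑ k ∈ s, μ k z z') = a * ∑ k ∈ s, flowCost c (μ k) := by
  unfold flowCost
  rw [sum_comm_three]
  simp only [Finset.mul_sum, Finset.sum_mul, mul_assoc]

/-- The error is an ℓ¹ norm of a linear function of the flow, hence convex. -/
lemma labelError_average_le (ha : 0 ≤ a) (ℓ : Z → L) (p : Z → L → ℝ) :
    labelError ℓ p (fun z z' => a * ∑ k ∈ s, μ k z z') ≤ a * ∑ k ∈ s, labelError ℓ p (μ k) := by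
  have h : ∀ z l,
      ∑ z' with ℓ z' = l, a * ∑ k ∈ s, μ k z z' - (∑ z', a * ∑ k ∈ s, μ k z z') * p z l
      = a * ∑ k ∈ s, (∑ z' with ℓ z' = l, μ k z z' - (∑ z', μ k z z') * p z l) := by
    intro z l
    rw [← Finset.mul_sum, ← Finset.mul_sum, Finset.sum_sub_distrib, ← Finset.sum_mul,
      Finset.sum_comm (s := s), Finset.sum_comm (s := s), mul_assoc, mul_sub]
  calc labelError ℓ p (fun z z' => a * ∑ k ∈ s, μ k z z')
      ≤ ∑ z, ∑ l, a * ∑ k ∈ s, |∑ z' with ℓ z' = l, μ k z z' - (∑ z', μ k z z') * p z l| := by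
        refine Finset.sum_le_sum fun z _ => Finset.sum_le_sum fun l _ => ?_
        rw [h, abs_mul, abs_of_nonneg ha]
        exact mul_le_mul_of_nonneg_left (Finset.abs_sum_le_sum_abs _ _) ha
    _ = a * ∑ k ∈ s, labelError ℓ p (μ k) := by
        simp only [labelError, ← Finset.mul_sum, sum_comm_three]

end Average

/-! ### The rounds of the algorithm -/

section Algorithm

variable {X Y : Type*} [Fintype X] [Fintype Y]

/-- `π` charges every transition that the two marginal chains allow. -/
def IsFull (PX : X → PMF X) (PY : Y → PMF Y) (π : X × Y → PMF (X × Y)) : Prop :=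
  ∀ z z', 0 < prob PX z.1 z'.1 → 0 < prob PY z.2 z'.2 → 0 < prob π z z'

lemma exists_prob_pos {S : Type*} [Fintype S] (P : S → PMF S) (s : S) : ∃ s', 0 < prob P s s' := by
  by_contra! h
  have h1 := sum_prob P s
  rw [Finset.sum_eq_zero fun s' _ => le_antisymm (h s') (prob_nonneg P s s')] at h1
  exact zero_ne_one h1

variable {PX : X → PMF X} {PY : Y → PMF Y} {c : X × Y → ℝ} {γ η : ℝ}
  {π π' : X × Y → PMF (X × Y)}

lemma bellmanSinkhornX_eq [DecidableEq X] (V : X × Y → X → ℝ) :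
    bellmanSinkhornX PX c γ η π V
      = bellmanSinkhorn Prod.fst (fun z x => prob PX z.1 x) c γ η (prob π) V := by
  ext z x
  exact congrArg (fun a => -(1 / η) * Real.log a) (sum_filter_fst (fun z' => prob π z z' / prob PX z.1 x *
    Real.exp (-η * qX PX c γ V z z')) x).symm

lemma bellmanSinkhornY_eq [DecidableEq Y] (V : X × Y → Y → ℝ) :
    bellmanSinkhornY PY c γ η π V
      = bellmanSinkhorn Prod.snd (fun z y => prob PY z.2 y) c γ η (prob π) V := by
  ext z y
  exact congrArg (fun a => -(1 / η) * Real.log a) (sum_filter_snd (fun z' => prob π z z' / prob PY z.2 y *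
    Real.exp (-η * qY PY c γ V z z')) y).symm

lemma updateX_eq [DecidableEq X] (V : X × Y → X → ℝ) (z z' : X × Y) :
    updateX PX c γ η π V z z'
      = labelUpdate Prod.fst (fun z x => prob PX z.1 x) c γ η (prob π) V z z' :=
  congrArg (fun a => prob π z z' * Real.exp (-η * qX PX c γ V z z') / a * prob PX z.1 z'.1)
    (sum_filter_fst (fun z'' => prob π z z'' * Real.exp (-η * qX PX c γ V z z'')) z'.1).symm

lemma updateY_eq [DecidableEq Y] (V : X × Y → Y → ℝ) (z z' : X × Y) :
    updateY PY c γ η π V z z'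
      = labelUpdate Prod.snd (fun z y => prob PY z.2 y) c γ η (prob π) V z z' :=
  congrArg (fun a => prob π z z' * Real.exp (-η * qY PY c γ V z z') / a * prob PY z.2 z'.2)
    (sum_filter_snd (fun z'' => prob π z z'' * Real.exp (-η * qY PY c γ V z z'')) z'.2).symm

/-- Full support is the invariant of the iteration: it keeps the normalizations positive wherever
P_X is, and the update preserves it. -/
lemma IsFull.updateX_spec [DecidableEq X] (h : IsFull PX PY π) (V : X × Y → X → ℝ) :
    (∀ z x, ∑ z' with z'.1 = x, updateX PX c γ η π V z z' = prob PX z.1 x) ∧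
      ∀ z z', 0 < prob PX z.1 z'.1 → 0 < prob PY z.2 z'.2 → 0 < updateX PX c γ η π V z z' := by
  constructor
  · intro z x
    simp only [updateX_eq]
    refine sum_labelUpdate (ℓ := Prod.fst) (p := fun z x => prob PX z.1 x) (prob_nonneg π) ?_ x
    intro x' hx'
    obtain ⟨y, hy⟩ := exists_prob_pos PY z.2
    exact ⟨(x', y), rfl, h z (x', y) ((prob_nonneg _ _ _).lt_of_ne' hx') hy⟩
  · intro z z' hX hY
    rw [updateX_eq]
    exact labelUpdate_pos (ℓ := Prod.fst) (prob_nonneg π) (h z z' hX hY) hX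

lemma IsFull.updateY_spec [DecidableEq Y] (h : IsFull PX PY π) (V : X × Y → Y → ℝ) :
    (∀ z y, ∑ z' with z'.2 = y, updateY PY c γ η π V z z' = prob PY z.2 y) ∧
      ∀ z z', 0 < prob PX z.1 z'.1 → 0 < prob PY z.2 z'.2 → 0 < updateY PY c γ η π V z z' := by
  constructor
  · intro z y
    simp only [updateY_eq]
    refine sum_labelUpdate (ℓ := Prod.snd) (p := fun z y => prob PY z.2 y) (prob_nonneg π) ?_ y
    intro y' hy'
    obtain ⟨x, hx⟩ := exists_prob_pos PX z.1
    exact ⟨(x, y'), rfl, h z (x, y') hx ((prob_nonneg _ _ _).lt_of_ne' hy')⟩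
  · intro z z' hX hY
    rw [updateY_eq]
    exact labelUpdate_pos (ℓ := Prod.snd) (prob_nonneg π) (h z z' hX hY) hY

lemma IsFull.exists_stepX (h : IsFull PX PY π) (c : X × Y → ℝ) (hγ₀ : 0 ≤ γ) (hγ₁ : γ < 1)
    (hη : 0 ≤ η) : ∃ π', IsFull PX PY π' ∧ ∃ V, bellmanSinkhornX PX c γ η π V = V ∧
      ∀ z z', prob π' z z' = updateX PX c γ η π V z z' := by
  classical
  obtain ⟨V, hV⟩ := exists_bellmanSinkhorn_eq (ℓ := (Prod.fst : X × Y → X))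
    (p := fun z x => prob PX z.1 x) (c := c) (π := prob π) hγ₀ hγ₁ hη (prob_nonneg π)
    (fun z => prob_nonneg PX z.1) (fun z => sum_prob PX z.1)
  obtain ⟨h1, h2⟩ := h.updateX_spec (c := c) (γ := γ) (η := η) V
  obtain ⟨π', hπ'⟩ := exists_prob_eq (f := updateX PX c γ η π V)
    (fun z z' => by
      rw [updateX_eq]
      exact labelUpdate_nonneg (prob_nonneg π) (fun z => prob_nonneg PX z.1) z z')
    (fun z => by rw [← sum_label _ Prod.fst]; simp only [h1, sum_prob])
  refine ⟨π', fun z z' hX hY => ?_, V, ?_, hπ'⟩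
  · rw [hπ']
    exact h2 z z' hX hY
  · rw [bellmanSinkhornX_eq, hV]

lemma IsFull.exists_stepY (h : IsFull PX PY π) (c : X × Y → ℝ) (hγ₀ : 0 ≤ γ) (hγ₁ : γ < 1)
    (hη : 0 ≤ η) : ∃ π', IsFull PX PY π' ∧ ∃ V, bellmanSinkhornY PY c γ η π V = V ∧
      ∀ z z', prob π' z z' = updateY PY c γ η π V z z' := by
  classical
  obtain ⟨V, hV⟩ := exists_bellmanSinkhorn_eq (ℓ := (Prod.snd : X × Y → Y))
    (p := fun z y => prob PY z.2 y) (c := c) (π := prob π) hγ₀ hγ₁ hη (prob_nonneg π)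
    (fun z => prob_nonneg PY z.2) (fun z => sum_prob PY z.2)
  obtain ⟨h1, h2⟩ := h.updateY_spec (c := c) (γ := γ) (η := η) V
  obtain ⟨π', hπ'⟩ := exists_prob_eq (f := updateY PY c γ η π V)
    (fun z z' => by
      rw [updateY_eq]
      exact labelUpdate_nonneg (prob_nonneg π) (fun z => prob_nonneg PY z.2) z z')
    (fun z => by rw [← sum_label _ Prod.snd]; simp only [h1, sum_prob])
  refine ⟨π', fun z z' hX hY => ?_, V, ?_, hπ'⟩
  · rw [hπ']
    exact h2 z z' hX hY
  · rw [bellmanSinkhornY_eq, hV]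

lemma exists_isSVI (c : X × Y → ℝ) (hγ₀ : 0 ≤ γ) (hγ₁ : γ < 1) (hη : 0 ≤ η) (K : ℕ)
    (h : IsFull PX PY π) : ∃ π', IsSVI PX PY c γ η K π π' := by
  have step : ∀ (k : ℕ) (ρ : {ρ // IsFull PX PY ρ}), ∃ ρ' : {ρ // IsFull PX PY ρ},
      (Odd k → ∃ V, bellmanSinkhornX PX c γ η ρ.1 V = V ∧
        ∀ z z', prob ρ'.1 z z' = updateX PX c γ η ρ.1 V z z') ∧
      (Even k → ∃ V, bellmanSinkhornY PY c γ η ρ.1 V = V ∧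
        ∀ z z', prob ρ'.1 z z' = updateY PY c γ η ρ.1 V z z') := by
    intro k ρ
    rcases Nat.even_or_odd k with hk | hk
    · obtain ⟨ρ', h1, h2⟩ := ρ.2.exists_stepY c hγ₀ hγ₁ hη
      exact ⟨⟨ρ', h1⟩, fun ho => absurd hk (Nat.not_even_iff_odd.2 ho), fun _ => h2⟩
    · obtain ⟨ρ', h1, h2⟩ := ρ.2.exists_stepX c hγ₀ hγ₁ hη
      exact ⟨⟨ρ', h1⟩, fun _ => h2, fun he => absurd he (Nat.not_even_iff_odd.2 hk)⟩
  choose next hnext using step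
  -- `seq n` is the iterate with index n + 1, so the step that leaves it has the parity of n + 1.
  let seq : ℕ → {ρ // IsFull PX PY ρ} := fun n => Nat.rec ⟨π, h⟩ (fun k ρ => next (k + 1) ρ) n
  refine ⟨fun k => (seq (k - 1)).1, rfl, ?_, ?_⟩
  · rintro (_ | k) hk _ ho
    · omega
    · exact (hnext (k + 1) (seq k)).1 ho
  · rintro (_ | k) hk _ he
    · omega
    · exact (hnext (k + 1) (seq k)).2 he

end Algorithm

section Algorithm

variable {X Y : Type*} [Fintype X] [Fintype Y]
  {PX : X → PMF X} {PY : Y → PMF Y} {c : X × Y → ℝ} {γ η : ℝ}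

/-! ### The output -/

/-- The factorization of μ survives the default value: a nonnegative row with sum 0 is zero. -/
lemma extract_spec {μ : X × Y → X × Y → ℝ} (hμ : ∀ z z', 0 ≤ μ z z') (z : X × Y) :
    (∀ z', 0 ≤ extract PX PY μ z z') ∧ ∑ z', extract PX PY μ z z' = 1 ∧
      ∀ z', μ z z' = (∑ z'', μ z z'') * extract PX PY μ z z' := by
  unfold extract
  have h0 : 0 ≤ ∑ z', μ z z' := Finset.sum_nonneg fun z' _ => hμ z z'
  split_ifs with h
  · refine ⟨fun z' => div_nonneg (hμ _ _) h0, ?_, fun z' => (mul_div_cancel₀ _ h).symm⟩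
    rw [← Finset.sum_div, div_self h]
  · push Not at h
    refine ⟨fun z' => mul_nonneg (prob_nonneg _ _ _) (prob_nonneg _ _ _), ?_, fun z' => ?_⟩
    · rw [Fintype.sum_prod_type]
      simp only [← Finset.mul_sum, sum_prob, mul_one]
    · rw [h, zero_mul]
      exact (Finset.sum_eq_zero_iff_of_nonneg fun z' _ => hμ z z').1 h z' (Finset.mem_univ _)

lemma roundCoupling_extract_spec (PX : X → PMF X) (PY : Y → PMF Y) {μ : X × Y → X × Y → ℝ}
    (hμ : ∀ z z', 0 ≤ μ z z') (z : X × Y) :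
    (∀ z', 0 ≤ roundCoupling (extract PX PY μ z) (prob PX z.1) (prob PY z.2) z') ∧
      ∑ z', roundCoupling (extract PX PY μ z) (prob PX z.1) (prob PY z.2) z' = 1 ∧
      ∑ z', |roundCoupling (extract PX PY μ z) (prob PX z.1) (prob PY z.2) z'
          - extract PX PY μ z z'|
        ≤ ∑ x, |∑ y, extract PX PY μ z (x, y) - prob PX z.1 x|
          + ∑ y, |∑ x, extract PX PY μ z (x, y) - prob PY z.2 y| :=
  roundCoupling_spec (extract_spec hμ z).1 (extract_spec hμ z).2.1 (prob_nonneg _ _) (sum_prob _ _)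
    (prob_nonneg _ _) (sum_prob _ _)

/-- The mass that is moved by rounding a flow is at most its constraint violation. -/
lemma sum_roundCoupling_extract_le [DecidableEq X] [DecidableEq Y] (PX : X → PMF X) (PY : Y → PMF Y)
    {μ : X × Y → X × Y → ℝ} (hμ : ∀ z z', 0 ≤ μ z z') :
    ∑ z, (∑ z', μ z z') * ∑ z', |roundCoupling (extract PX PY μ z) (prob PX z.1) (prob PY z.2) z'
        - extract PX PY μ z z'|
      ≤ labelError Prod.fst (fun z x => prob PX z.1 x) μ
        + labelError Prod.snd (fun z y => prob PY z.2 y) μ := by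
  unfold labelError
  rw [← Finset.sum_add_distrib]
  refine Finset.sum_le_sum fun z _ => ?_
  have h0 : 0 ≤ ∑ z', μ z z' := Finset.sum_nonneg fun z' _ => hμ z z'
  refine (mul_le_mul_of_nonneg_left (roundCoupling_extract_spec PX PY hμ z).2.2 h0).trans_eq ?_
  rw [mul_add, Finset.mul_sum, Finset.mul_sum]
  congr 1
  · refine Finset.sum_congr rfl fun x _ => ?_
    rw [sum_filter_fst (μ z) x, Finset.sum_congr rfl fun y _ => (extract_spec hμ z).2.2 (x, y),
      ← Finset.mul_sum, ← mul_sub, abs_mul, abs_of_nonneg h0]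
  · refine Finset.sum_congr rfl fun y _ => ?_
    rw [sum_filter_snd (μ z) y, Finset.sum_congr rfl fun x _ => (extract_spec hμ z).2.2 (x, y),
      ← Finset.mul_sum, ← mul_sub, abs_mul, abs_of_nonneg h0]

variable [MeasurableSpace X] [MeasurableSpace Y]
  [MeasurableSingletonClass X] [MeasurableSingletonClass Y]

lemma avgOccupancy_eq (hγ₀ : 0 ≤ γ) (hγ₁ : γ < 1) (z₀ : X × Y) (K : ℕ)
    (π : ℕ → X × Y → PMF (X × Y)) : avgOccupancy γ z₀ K π = fun z z' =>
      1 / (K : ℝ) * ∑ k ∈ Finset.Icc 1 K, discountedPair γ (chainLaw (π k) z₀) z z' := by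
  ext z z'
  simp only [avgOccupancy, occupancy_eq hγ₀ hγ₁]

lemma isFlow_avgOccupancy (hγ₀ : 0 ≤ γ) (hγ₁ : γ < 1) (z₀ : X × Y) {K : ℕ} (hK : 1 ≤ K)
    (π : ℕ → X × Y → PMF (X × Y)) : IsFlow γ z₀ (avgOccupancy γ z₀ K π) := by
  rw [avgOccupancy_eq hγ₀ hγ₁]
  have hK' : (K : ℝ) ≠ 0 := by positivity
  refine isFlow_average (by positivity) ?_ fun k _ => isFlow_chainLaw hγ₀ hγ₁ (π k) z₀
  rw [Nat.card_Icc, Nat.add_sub_cancel, one_div, inv_mul_cancel₀ hK']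

lemma exists_isOutput (hγ₀ : 0 ≤ γ) (hγ₁ : γ < 1) (z₀ : X × Y) {K : ℕ} (hK : 1 ≤ K)
    (π : ℕ → X × Y → PMF (X × Y)) : ∃ πout, IsOutput PX PY γ z₀ K π πout := by
  have h := fun z => roundCoupling_extract_spec PX PY
    (isFlow_avgOccupancy hγ₀ hγ₁ z₀ hK π).nonneg z
  exact exists_prob_eq (fun z => (h z).1) fun z => (h z).2.1

/-- The value of the output is controlled by the cost and the constraint violation of the average
occupancy. -/
lemma IsOutput.value_le [DecidableEq X] [DecidableEq Y] (hγ₀ : 0 ≤ γ) (hγ₁ : γ < 1) {C : ℝ}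
    (hc₀ : ∀ z, 0 ≤ c z) (hc : ∀ z, c z ≤ C) {z₀ : X × Y} {K : ℕ} (hK : 1 ≤ K)
    {π : ℕ → X × Y → PMF (X × Y)} {πout : X × Y → PMF (X × Y)}
    (h : IsOutput PX PY γ z₀ K π πout) :
    (1 - γ) * value c γ πout z₀ ≤ 1 / (K : ℝ) * ∑ k ∈ Finset.Icc 1 K,
      (flowCost c (discountedPair γ (chainLaw (π k) z₀)) + C / (1 - γ) *
        (labelError Prod.fst (fun z x => prob PX z.1 x) (discountedPair γ (chainLaw (π k) z₀)) +
        labelError Prod.snd (fun z y => prob PY z.2 y)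
          (discountedPair γ (chainLaw (π k) z₀)))) := by
  have hflow := isFlow_avgOccupancy hγ₀ hγ₁ z₀ hK π
  obtain ⟨U, hU, hUB⟩ := exists_bellman_eq hγ₀ hγ₁ (prob_nonneg πout) (sum_prob πout) hc₀ hc
  rw [value_eq_of_bellman hγ₀ hγ₁ c πout z₀ hU]
  -- The averaged flow moves by the extracted kernel, the output by its rounding; U is the value of
  -- the output.
  have h1 := hflow.performance hγ₀ hγ₁.le (fun z z' => (extract_spec (PX := PX) (PY := PY)
    hflow.nonneg z).2.2 z') hU hUB
  have h2 := sum_roundCoupling_extract_le PX PY hflow.nonneg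
  simp only [← h _ _] at h2
  have hB : 0 ≤ C / (1 - γ) := (hUB z₀).1.trans (hUB z₀).2
  refine h1.trans ?_
  rw [Finset.sum_add_distrib, ← Finset.mul_sum, Finset.sum_add_distrib, mul_add, mul_left_comm,
    mul_add (1 / (K : ℝ))]
  refine add_le_add ?_ (mul_le_mul_of_nonneg_left (h2.trans ?_) hB)
  · rw [avgOccupancy_eq hγ₀ hγ₁, flowCost_average]
  · rw [avgOccupancy_eq hγ₀ hγ₁]
    exact add_le_add (labelError_average_le (by positivity) _ _)
      (labelError_average_le (by positivity) _ _)

/-! ### Regret -/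

/-- The regret and the constraint violation of the first `n` iterates. -/
lemma IsSVI.sum_bound [DecidableEq X] [DecidableEq Y] (hγ₀ : 0 ≤ γ) (hγ₁ : γ < 1) {C : ℝ}
    (hc₀ : ∀ z, 0 ≤ c z) (hc : ∀ z, c z ≤ C) (hη : 0 < η) {b : ℝ} (hb : 0 ≤ b)
    {z₀ : X × Y} {K : ℕ} {π₁ : X × Y → PMF (X × Y)} {π : ℕ → X × Y → PMF (X × Y)}
    (h : IsSVI PX PY c γ η K π₁ π) (hπ₁ : IsFull PX PY π₁) {μs : X × Y → X × Y → ℝ}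
    (hμs : IsFlow γ z₀ μs) (hμX : HasLabelLaw Prod.fst (fun z x => prob PX z.1 x) μs)
    (hμY : HasLabelLaw Prod.snd (fun z y => prob PY z.2 y) μs) (n : ℕ) (hn : 1 ≤ n) (hnK : n ≤ K) :
    IsFull PX PY (π n) ∧
    (n ≠ 1 → Even n → ∀ z x, ∑ z' with z'.1 = x, prob (π n) z z' = prob PX z.1 x) ∧
    (n ≠ 1 → Odd n → ∀ z y, ∑ z' with z'.2 = y, prob (π n) z z' = prob PY z.2 y) ∧
    ∑ k ∈ Finset.Icc 1 n,
      (η * (flowCost c (discountedPair γ (chainLaw (π k) z₀)) - flowCost c μs) + b *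
        (labelError Prod.fst (fun z x => prob PX z.1 x) (discountedPair γ (chainLaw (π k) z₀)) +
        labelError Prod.snd (fun z y => prob PY z.2 y) (discountedPair γ (chainLaw (π k) z₀))))
      ≤ η * C + 4 * b + (if n = 1 then 0 else 2 * b)
        + ∑ z, ∑ z', μs z z' * (Real.log (prob (π n) z z') - Real.log (prob (π 1) z z'))
        + n * b ^ 2 := by
  have hfl : ∀ k, IsFlow γ z₀ (discountedPair γ (chainLaw (π k) z₀)) := fun k =>
    isFlow_chainLaw hγ₀ hγ₁ (π k) z₀
  have hpX₀ : ∀ (z : X × Y) x, 0 ≤ prob PX z.1 x := fun z => prob_nonneg PX z.1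
  have hpY₀ : ∀ (z : X × Y) y, 0 ≤ prob PY z.2 y := fun z => prob_nonneg PY z.2
  have hpX₁ : ∀ z : X × Y, ∑ x, prob PX z.1 x = 1 := fun z => sum_prob PX z.1
  have hpY₁ : ∀ z : X × Y, ∑ y, prob PY z.2 y = 1 := fun z => sum_prob PY z.2
  induction n, hn using Nat.le_induction with
  | base =>
    refine ⟨h.init ▸ hπ₁, fun h => absurd rfl h, fun h => absurd rfl h, ?_⟩
    -- The uniform iterate need not meet either constraint: cost at most C and two errors of at most
    -- 2 give η C + 4 b.
    have h1 := flowCost_le hc hγ₁ (hfl 1)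
    have h2 := flowCost_nonneg hc₀ hμs
    have h3 := labelError_le_two (hfl 1) hγ₁ Prod.fst hpX₀ hpX₁
    have h4 := labelError_le_two (hfl 1) hγ₁ Prod.snd hpY₀ hpY₁
    have h5 := mul_le_mul_of_nonneg_left (add_le_add h3 h4) hb
    have h6 := mul_le_mul_of_nonneg_left (sub_le_sub h1 h2) hη.le
    simp only [Finset.Icc_self, Finset.sum_singleton, sub_self, mul_zero, Finset.sum_const_zero,
      if_true, Nat.cast_one, one_mul, add_zero]
    nlinarith [sq_nonneg b]
  | succ n hn ih =>
    obtain ⟨ihF, ihX, ihY, ihS⟩ := ih (by omega)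
    -- The comparator charges only transitions that both marginal chains allow, so its log ratios
    -- avoid log 0.
    have hsupp : ∀ z z', 0 < μs z z' → 0 < prob (π n) z z' := fun z z' hz =>
      ihF z z' (hμX.pos hμs.nonneg hz) (hμY.pos hμs.nonneg hz)
    have hn1 : n + 1 ≠ 1 := by omega
    have hlog : ∑ z, ∑ z', μs z z' *
          (Real.log (prob (π (n + 1)) z z') - Real.log (prob (π 1) z z'))
        = ∑ z, ∑ z', μs z z' * (Real.log (prob (π n) z z') - Real.log (prob (π 1) z z'))
        + ∑ z, ∑ z', μs z z' *
          (Real.log (prob (π (n + 1)) z z') - Real.log (prob (π n) z z')) := by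
      simp only [← Finset.sum_add_distrib, ← mul_add]
      refine Finset.sum_congr rfl fun z _ => Finset.sum_congr rfl fun z' _ => ?_
      ring
    rw [Finset.sum_Icc_succ_top (by omega), hlog, if_neg hn1]
    -- Common to both parities. The extra 2 b is paid only on leaving π₁, which need not meet the
    -- other constraint.
    have hcombine : ∀ r : ℝ, r ≤ ∑ z, ∑ z', μs z z' *
          (Real.log (prob (π (n + 1)) z z') - Real.log (prob (π n) z z')) + b ^ 2
          + (if n = 1 then 2 * b else 0) →
        ∑ k ∈ Finset.Icc 1 n,
          (η * (flowCost c (discountedPair γ (chainLaw (π k) z₀)) - flowCost c μs) + b *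
            (labelError Prod.fst (fun z x => prob PX z.1 x)
              (discountedPair γ (chainLaw (π k) z₀)) +
            labelError Prod.snd (fun z y => prob PY z.2 y)
              (discountedPair γ (chainLaw (π k) z₀)))) + r
        ≤ η * C + 4 * b + 2 * b
          + (∑ z, ∑ z', μs z z' * (Real.log (prob (π n) z z') - Real.log (prob (π 1) z z'))
          + ∑ z, ∑ z', μs z z' *
            (Real.log (prob (π (n + 1)) z z') - Real.log (prob (π n) z z')))
          + ((n + 1 : ℕ) : ℝ) * b ^ 2 := by
      intro r hr
      push_cast
      split_ifs at hr ihS <;> linarith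
    rcases Nat.even_or_odd n with he | ho
    · obtain ⟨V, hV, hu⟩ := h.even_step n hn (by omega) he
      obtain ⟨s1, s2⟩ := ihF.updateY_spec (c := c) (γ := γ) (η := η) V
      simp only [← hu] at s1 s2
      rw [bellmanSinkhornY_eq] at hV
      simp only [updateY_eq] at hu
      refine ⟨s2, fun _ he' => absurd he' (by simpa [Nat.even_add_one] using he), fun _ _ => s1,
        hcombine _ ?_⟩
      have hr := round_bound (ℓ' := Prod.fst) (p' := fun z x => prob PX z.1 x) hγ₁ hη.ne' hb
        (prob_nonneg _) (prob_nonneg _) (sum_prob _) (sum_prob _) hpX₀ hpX₁ hV hu s1 hμs hμY hsupp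
        (hfl (n + 1)) (discountedPair_chainLaw hγ₀ hγ₁ (π (n + 1)) z₀)
        (e := if n = 1 then 2 * b else 0) (by
          split_ifs with h1
          · exact Or.inl le_rfl
          · exact Or.inr ⟨le_rfl, ihX h1 he⟩)
      rwa [add_comm (labelError Prod.snd _ _)] at hr
    · obtain ⟨V, hV, hu⟩ := h.odd_step n hn (by omega) ho
      obtain ⟨s1, s2⟩ := ihF.updateX_spec (c := c) (γ := γ) (η := η) V
      simp only [← hu] at s1 s2
      rw [bellmanSinkhornX_eq] at hV
      simp only [updateX_eq] at hu
      refine ⟨s2, fun _ _ => s1, fun _ ho' => absurd ho' (by simpa [Nat.odd_add_one] using ho),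
        hcombine _ ?_⟩
      exact round_bound (ℓ' := Prod.snd) (p' := fun z y => prob PY z.2 y) hγ₁ hη.ne' hb
        (prob_nonneg _) (prob_nonneg _) (sum_prob _) (sum_prob _) hpY₀ hpY₁ hV hu s1 hμs hμX hsupp
        (hfl (n + 1)) (discountedPair_chainLaw hγ₀ hγ₁ (π (n + 1)) z₀)
        (e := if n = 1 then 2 * b else 0) (by
          split_ifs with h1
          · exact Or.inl le_rfl
          · exact Or.inr ⟨le_rfl, ihY h1 ho⟩)

omit [MeasurableSpace X] [MeasurableSpace Y] [MeasurableSingletonClass X]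
  [MeasurableSingletonClass Y] in
lemma prob_uniform [Nonempty X] [Nonempty Y] (z z' : X × Y) :
    prob (fun _ : X × Y => PMF.uniformOfFintype (X × Y)) z z'
      = ((Fintype.card X : ℝ) * (Fintype.card Y : ℝ))⁻¹ := by
  simp [prob, PMF.uniformOfFintype_apply, Fintype.card_prod]

omit [MeasurableSpace X] [MeasurableSpace Y] [MeasurableSingletonClass X]
  [MeasurableSingletonClass Y] in
lemma isFull_uniform [Nonempty X] [Nonempty Y] :
    IsFull PX PY (fun _ : X × Y => PMF.uniformOfFintype (X × Y)) := by
  intro z z' _ _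
  rw [prob_uniform]
  positivity

/-- The suboptimality of the output with respect to any flow with the correct marginals. -/
lemma IsSVI.value_le [Nonempty X] [Nonempty Y] [DecidableEq X] [DecidableEq Y]
    (hγ₀ : 0 ≤ γ) (hγ₁ : γ < 1) {C : ℝ} (hC : 0 ≤ C)
    (hc₀ : ∀ z, 0 ≤ c z) (hc : ∀ z, c z ≤ C) (hη : 0 < η)
    {z₀ : X × Y} {K : ℕ} (hK : 1 ≤ K) {π : ℕ → X × Y → PMF (X × Y)}
    {πout : X × Y → PMF (X × Y)}
    (h : IsSVI PX PY c γ η K (fun _ => PMF.uniformOfFintype (X × Y)) π)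
    (hout : IsOutput PX PY γ z₀ K π πout) {μs : X × Y → X × Y → ℝ}
    (hμs : IsFlow γ z₀ μs) (hμX : HasLabelLaw Prod.fst (fun z x => prob PX z.1 x) μs)
    (hμY : HasLabelLaw Prod.snd (fun z y => prob PY z.2 y) μs) :
    η * K * ((1 - γ) * value c γ πout z₀ - flowCost c μs)
      ≤ η * C + 6 * (η * (C / (1 - γ)))
        + Real.log ((Fintype.card X : ℝ) * (Fintype.card Y : ℝ)) + K * (η * (C / (1 - γ))) ^ 2 := by
  have hB : 0 ≤ C / (1 - γ) := div_nonneg hC (by linarith)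
  have hK' : (0 : ℝ) < K := by exact_mod_cast hK
  obtain ⟨-, -, -, hsum⟩ := h.sum_bound hγ₀ hγ₁ hc₀ hc hη (b := η * (C / (1 - γ))) (by positivity)
    isFull_uniform hμs hμX hμY K hK le_rfl
  have hval := hout.value_le hγ₀ hγ₁ hc₀ hc hK
  have hlog : ∑ z, ∑ z', μs z z' * (Real.log (prob (π K) z z') - Real.log (prob (π 1) z z'))
      ≤ Real.log ((Fintype.card X : ℝ) * (Fintype.card Y : ℝ)) := by
    calc _ ≤ ∑ z, ∑ z', μs z z' * Real.log ((Fintype.card X : ℝ) * (Fintype.card Y : ℝ)) := by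
          refine Finset.sum_le_sum fun z _ => Finset.sum_le_sum fun z' _ =>
            mul_le_mul_of_nonneg_left ?_ (hμs.nonneg z z')
          -- The telescoped log ratio is at most -log π₁, since probabilities are at most 1.
          rw [h.init, prob_uniform, Real.log_inv]
          linarith [Real.log_nonpos (prob_nonneg (π K) z z') (prob_le_one (π K) z z')]
      _ = _ := by simp only [← Finset.sum_mul]; rw [hμs.sum_eq_one hγ₁, one_mul]
  have hval' := mul_le_mul_of_nonneg_left hval (mul_pos hη hK').le
  have hcancel : ∀ s : ℝ, η * K * (1 / K * s) = η * s := fun s => by field_simp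
  rw [hcancel] at hval'
  have hsplit : ∑ k ∈ Finset.Icc 1 K,
      (η * (flowCost c (discountedPair γ (chainLaw (π k) z₀)) - flowCost c μs)
        + η * (C / (1 - γ)) *
        (labelError Prod.fst (fun z x => prob PX z.1 x) (discountedPair γ (chainLaw (π k) z₀)) +
        labelError Prod.snd (fun z y => prob PY z.2 y) (discountedPair γ (chainLaw (π k) z₀))))
      = η * ∑ k ∈ Finset.Icc 1 K,
      (flowCost c (discountedPair γ (chainLaw (π k) z₀)) + C / (1 - γ) *
        (labelError Prod.fst (fun z x => prob PX z.1 x) (discountedPair γ (chainLaw (π k) z₀)) +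
        labelError Prod.snd (fun z y => prob PY z.2 y)
          (discountedPair γ (chainLaw (π k) z₀)))) - η * (K * flowCost c μs) := by
    have h1 : (K : ℝ) * flowCost c μs = ∑ k ∈ Finset.Icc 1 K, flowCost c μs := by simp
    rw [h1, ← mul_sub, ← Finset.sum_sub_distrib, Finset.mul_sum]
    refine Finset.sum_congr rfl fun k _ => ?_
    ring
  rw [hsplit] at hsum
  have hif : (if K = 1 then 0 else 2 * (η * (C / (1 - γ)))) ≤ 2 * (η * (C / (1 - γ))) := by
    split_ifs
    · positivity
    · exact le_rfl
  linarith

end Algorithm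

/-- The bound on the suboptimality for the prescribed learning rate. -/
lemma suboptimality_le {A C D H ε η : ℝ} {K : ℕ} (hC : 0 < C) (hD : Real.log 2 ≤ D) (hH₀ : 0 < H)
    (hH₁ : H < 1) (hε : 0 < ε) (hK₁ : 1 ≤ K) (hK : 324 * C ^ 2 * D / (H ^ 5 * ε ^ 2) ≤ (K : ℝ))
    (hη : η = 1 / (4 * C) * √(H ^ 3 * D / K))
    (hA : η * K * A ≤ η * C + 6 * (η * (C / H)) + D + K * (η * (C / H)) ^ 2) : A ≤ H * ε := by
  have hK' : (1 : ℝ) ≤ K := by exact_mod_cast hK₁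
  have hK₀ : (0 : ℝ) < K := by linarith
  have hD₁ : 0.69 < D := by linarith [Real.log_two_gt_d9]
  have hD₀ : 0 < D := by linarith
  -- In terms of t the square root disappears: η = t H / (4 C), η C / H = t / 4 and K t² = H D.
  obtain ⟨t, ht₀, ht⟩ : ∃ t, 0 < t ∧ √(H ^ 3 * D / K) = t * H :=
    ⟨√(H ^ 3 * D / K) / H, by positivity, by field_simp⟩
  have ht2 : K * t ^ 2 = H * D := by
    have h1 : (t * H) ^ 2 = H ^ 3 * D / K := by rw [← ht, Real.sq_sqrt (by positivity)]
    field_simp at h1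
    nlinarith
  have hηt : η = t * H / (4 * C) := by rw [hη, ht]; ring
  -- The lower bound on K after a square root; 324 = 18².
  have hε' : 18 * C * t / H ^ 3 ≤ ε := by
    refine (abs_le_of_sq_le_sq' ?_ hε.le).2
    rw [div_le_iff₀ (by positivity)] at hK
    have h1 : (18 * C * t / H ^ 3) ^ 2 = 324 * C ^ 2 * (K * t ^ 2) / (K * H ^ 6) := by
      field_simp; norm_num
    rw [h1, ht2, div_le_iff₀ (by positivity)]
    nlinarith
  -- From t² ≤ D and D > 0.69, as 1.21² * 0.69 > 1.
  have ht1 : t ≤ 1.21 * D := by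
    have h2 : t ^ 2 ≤ D := by nlinarith [sq_nonneg t]
    nlinarith
  have hηK : 0 < η * K := by rw [hηt]; positivity
  have h3 : η * K * (18 * C * t / H ^ 2) ≤ η * K * (H * ε) := by
    refine mul_le_mul_of_nonneg_left ?_ hηK.le
    have := mul_le_mul_of_nonneg_left hε' hH₀.le
    calc 18 * C * t / H ^ 2 = H * (18 * C * t / H ^ 3) := by field_simp
      _ ≤ _ := this
  have h4 : η * K * (18 * C * t / H ^ 2) = 4.5 * D := by
    have : η * K * (18 * C * t / H ^ 2) = 4.5 * (K * t ^ 2) / H := by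
      rw [hηt]; field_simp; norm_num
    rw [this, ht2]
    field_simp
  have h5 : η * C = t * H / 4 := by rw [hηt]; field_simp
  have h6 : η * (C / H) = t / 4 := by rw [hηt]; field_simp
  refine le_of_mul_le_mul_left ?_ hηK
  rw [h5, h6] at hA
  -- The right-hand side is at most 1.75 t + (17 / 16) D, which is below 4.5 D.
  nlinarith

/-! ### The infimum over couplings, and one-point state spaces -/

section Degenerate

variable {X Y : Type*} [Fintype X] [Fintype Y] [MeasurableSpace X] [MeasurableSpace Y]
  [MeasurableSingletonClass X] [MeasurableSingletonClass Y]

/-- To bound the transport distance from below it suffices to bound the cost of each bicausal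
coupling. -/
lemma le_transportDist_add {PX : X → PMF X} {PY : Y → PMF Y} {c : X × Y → ℝ} {γ ε v : ℝ} {x₀ : X}
    {y₀ : Y} (h : ∀ M, IsBicausal PX PY x₀ y₀ M → v ≤ ∫ ω, discountedCost c γ ω ∂M + ε) :
    v ≤ transportDist PX PY c γ x₀ y₀ + ε := by
  rw [← sub_le_iff_le_add]
  obtain ⟨M₀, hM₀⟩ := exists_isBicausal PX PY x₀ y₀
  refine le_csInf ⟨_, M₀, hM₀, rfl⟩ ?_
  rintro r ⟨M, hM, rfl⟩
  exact sub_le_iff_le_add.2 (h M hM)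

lemma integral_eq_of_subsingleton {S : Type*} [MeasurableSpace S] [Subsingleton S]
    (M N : Measure (ℕ → S)) [IsProbabilityMeasure M] [IsProbabilityMeasure N] (f : (ℕ → S) → ℝ) :
    ∫ ω, f ω ∂M = ∫ ω, f ω ∂N := by
  obtain ⟨ω₀⟩ := M.nonempty_of_neZero
  have hf : f = fun _ => f ω₀ := funext fun ω => congrArg f (Subsingleton.elim ω ω₀)
  rw [hf]
  simp

end Degenerate

end MarkovOT

end

theorem theorem2 {X Y : Type*} [Fintype X] [Fintype Y] [Nonempty X] [Nonempty Y]
    [MeasurableSpace X] [MeasurableSpace Y]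
    [MeasurableSingletonClass X] [MeasurableSingletonClass Y]
    (PX : X → PMF X) (PY : Y → PMF Y) (c : X × Y → ℝ) (hc : ∀ z, 0 ≤ c z)
    (γ : ℝ) (hγ₀ : 0 < γ) (hγ₁ : γ < 1) (ε : ℝ) (hε : 0 < ε) (x₀ : X) (y₀ : Y)
    (K : ℕ) (hK₁ : 1 ≤ K)
    (hK : 324 * ‖c‖ ^ 2 * Real.log ((Fintype.card X : ℝ) * (Fintype.card Y : ℝ)) /
      ((1 - γ) ^ 5 * ε ^ 2) ≤ (K : ℝ))
    (η : ℝ)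
    (hη : η = 1 / (4 * ‖c‖) * Real.sqrt ((1 - γ) ^ 3 *
      Real.log ((Fintype.card X : ℝ) * (Fintype.card Y : ℝ)) / (K : ℝ))) :
    (∃ (π : ℕ → X × Y → PMF (X × Y)) (πout : X × Y → PMF (X × Y)),
      MarkovOT.IsSVI PX PY c γ η K (fun _ => PMF.uniformOfFintype (X × Y)) π ∧
      MarkovOT.IsOutput PX PY γ (x₀, y₀) K π πout) ∧
    ∀ (π : ℕ → X × Y → PMF (X × Y)) (πout : X × Y → PMF (X × Y)),
      MarkovOT.IsSVI PX PY c γ η K (fun _ => PMF.uniformOfFintype (X × Y)) π →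
      MarkovOT.IsOutput PX PY γ (x₀, y₀) K π πout →
      MarkovOT.value c γ πout (x₀, y₀) ≤ MarkovOT.transportDist PX PY c γ x₀ y₀ + ε := by
  classical
  have hCle : ∀ z, c z ≤ ‖c‖ := fun z => (le_abs_self _).trans (norm_le_pi_norm c z)
  have hη₀ : 0 ≤ η := by rw [hη]; positivity
  refine ⟨?_, fun π πout hsvi hout => MarkovOT.le_transportDist_add fun M hM => ?_⟩
  · obtain ⟨π, hπ⟩ := MarkovOT.exists_isSVI c hγ₀.le hγ₁ hη₀ K
      (MarkovOT.isFull_uniform (PX := PX) (PY := PY))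
    obtain ⟨πout, hout⟩ := MarkovOT.exists_isOutput (PX := PX) (PY := PY) hγ₀.le hγ₁ (x₀, y₀) hK₁ π
    exact ⟨π, πout, hπ, hout⟩
  have hprob := hM.isProbabilityMeasure
  by_cases hc0 : c = 0
  -- In the two degenerate cases η = 0 and the regret bound is empty; here all costs vanish, and
  -- below there is only one trajectory.
  · simp [MarkovOT.value, MarkovOT.discountedCost, hc0, hε.le]
  by_cases hcard : Fintype.card (X × Y) ≤ 1
  · have : Subsingleton (X × Y) := Fintype.card_le_one_iff_subsingleton.1 hcard
    rw [MarkovOT.value, MarkovOT.integral_eq_of_subsingleton _ M]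
    linarith
  have hC : 0 < ‖c‖ := norm_pos_iff.2 hc0
  have hD : Real.log 2 ≤ Real.log ((Fintype.card X : ℝ) * (Fintype.card Y : ℝ)) := by
    refine Real.log_le_log two_pos ?_
    rw [Fintype.card_prod] at hcard
    exact_mod_cast not_le.1 hcard
  have hη₁ : 0 < η := by
    have h1 : 0 < 1 - γ := by linarith
    have h2 := (Real.log_pos one_lt_two).trans_le hD
    have h3 : (0 : ℝ) < K := by exact_mod_cast hK₁
    rw [hη]
    positivity
  -- `M` need not be a Markov chain; only its occupancy enters the comparison.
  have hμ := MarkovOT.isFlow_discountedPair hγ₀.le hγ₁ M hM.zero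
  have hmain := hsvi.value_le hγ₀.le hγ₁ hC.le hc hCle hη₁ hK₁ hout hμ
    (hM.isMarkovAlong_fst.sum_discountedPair hγ₀.le hγ₁)
    (hM.isMarkovAlong_snd.sum_discountedPair hγ₀.le hγ₁)
  have hsub := MarkovOT.suboptimality_le hC hD (by linarith) (by linarith) hε hK₁ hK hη hmain
  have hcost : (1 - γ) * ∫ ω, MarkovOT.discountedCost c γ ω ∂M
      = MarkovOT.flowCost c (MarkovOT.discountedPair γ M) :=
    MarkovOT.integral_discountedCost hγ₀.le hγ₁ M c
  rw [← hcost, ← mul_sub] at hsub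
  linarith [le_of_mul_le_mul_left hsub (by linarith)]
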